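/- Let $m>0$, and let $V_1,V_2:\mathbb{R}^3\to\mathbb{R}$ satisfy $(V_1)$: $V_i\in L^\infty_{\rm loc}(\mathbb{R}^3)$, $\lim_{|x|\to\infty}V_i(x)=\infty$ and $\inf_{x\in\mathbb{R}^3}V_i(x)=0$, for $i=1,2$. Write $\mathcal{F}u(\xi)=\int_{\mathbb{R}^3}e^{-2\pi i\xi\cdot x}u(x)\,dx$ for the ($L^2$-)Fourier transform, and let $H^{1/2}(\mathbb{R}^3)$ be the space of real-valued $u\in L^2(\mathbb{R}^3)$ with $\int_{\mathbb{R}^3}(1+2\pi|\xi|)|\mathcal{F}u(\xi)|^2d\xi<\infty$. For $u\in H^{1/2}(\mathbb{R}^3)$ put $$\|(-\Delta)^{1/4}u\|_2^2=\int_{\mathbb{R}^3}2\pi|\xi|\,|\mathcal{F}u(\xi)|^2d\xi,\quad (\sqrt{-\Delta+m^2}\,u,u)=\int_{\mathbb{R}^3}\sqrt{|2\pi\xi|^2+m^2}\,|\mathcal{F}u(\xi)|^2d\xi,\quad \phi_u(x)=\int_{\mathbb{R}^3}\frac{u(y)^2}{|x-y|}dy.$$ Let $\mathcal{M}$ be the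 set of pairs $(u_1,u_2)$ with $u_i\in H^{1/2}(\mathbb{R}^3)$, $\int_{\mathbb{R}^3} V_iu_i^2\,dx<\infty$ and $\int_{\mathbb{R}^3} u_i^2\,dx=1$ for $i=1,2$. For $a_1,a_2>0$ and $\beta\in\mathbb{R}$ let $$E_{a_1,a_2,\beta}(u_1,u_2)=\sum_{i=1}^2\Big[(\sqrt{-\Delta+m^2}\,u_i,u_i)+\int_{\mathbb{R}^3} V_iu_i^2\,dx-\frac{a_i}{2}\int_{\mathbb{R}^3}\phi_{u_i}u_i^2\,dx\Big]-\beta\int_{\mathbb{R}^3}\phi_{u_1}u_2^2\,dx,$$ $$\hat e(a_1,a_2,\beta)=\inf_{(u_1,u_2)\in\mathcal{M}}E_{a_1,a_2,\beta}(u_1,u_2)\in[-\infty,\infty),$$ and, with $\beta^+=\max\{0,\beta\}$, $$\eta(a_1,a_2,\beta)=\inf\left\{\frac{2\|(-\Delta)^{1/4}u_1\|_2^2+2\|(-\Delta)^{1/4}u_2\|_2^2}{a_1\int\phi_{u_1}u_1^2dx+a_2\int\phi_{u_2}u_2^2dx+2\beta^+\int\phi_{u_1}u_2^2dx}\;:\;u_i\in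 H^{1/2}(\mathbb{R}^3),\ \|u_i\|_2=1,\ i=1,2\right\}.$$ A minimizer of $\hat e(a_1,a_2,\beta)$ is a pair $(u_1,u_2)\in\mathcal{M}$ with $E_{a_1,a_2,\beta}(u_1,u_2)=\hat e(a_1,a_2,\beta)$. Then: (i) if $\eta(a_1,a_2,\beta)>1$, then $\hat e(a_1,a_2,\beta)$ has a minimizer; (ii) if $\eta(a_1,a_2,\beta)<1$, then $\hat e(a_1,a_2,\beta)$ has no minimizer. -/

import Mathlib

open MeasureTheory Filter
open scoped FourierTransform ENNReal

noncomputable section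

namespace PseudoHartree

/-- Euclidean space `ℝ³`. -/
abbrev R3 : Type := EuclideanSpace ℝ (Fin 3)

/-- The real Hilbert space `L²(ℝ³; ℝ)`. -/
abbrev L2 : Type := Lp ℝ 2 (volume : Measure R3)

/-- The Fourier (Plancherel) transform of a real `L²` function, normalized as
`∫ exp(-2πi ξ·x) u(x) dx`. -/
def fourierL2 (u : L2) : Lp ℂ 2 (volume : Measure R3) :=
  𝓕 (Complex.ofRealCLM.compLp u)

/-- Membership in the real Sobolev space `H^{1/2}(ℝ³)`:
`∫ (1 + 2π|ξ|) |𝓕u(ξ)|² dξ < ∞`. -/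
def MemHHalf (u : L2) : Prop :=
  Integrable (fun ξ : R3 => (1 + 2 * Real.pi * ‖ξ‖) * ‖fourierL2 u ξ‖ ^ 2)

/-- `‖(-Δ)^{1/4} u‖₂² = ∫ 2π|ξ| |𝓕u(ξ)|² dξ`. -/
def quarterLaplacianSq (u : L2) : ℝ :=
  ∫ ξ : R3, 2 * Real.pi * ‖ξ‖ * ‖fourierL2 u ξ‖ ^ 2

/-- `(√(-Δ + m²) u, u) = ∫ √(|2πξ|² + m²) |𝓕u(ξ)|² dξ`. -/
def kinetic (m : ℝ) (u : L2) : ℝ :=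
  ∫ ξ : R3, Real.sqrt ((2 * Real.pi * ‖ξ‖) ^ 2 + m ^ 2) * ‖fourierL2 u ξ‖ ^ 2

/-- `φ_u(x) = (|·|⁻¹ * u²)(x) = ∫ u(y)² / |x - y| dy`. -/
def phi (u : L2) (x : R3) : ℝ :=
  ∫ y : R3, u y ^ 2 / ‖x - y‖

/-- `∫ φ_u v² dx = ∬ u(y)² v(x)² / |x - y| dy dx`. -/
def coulomb (u v : L2) : ℝ :=
  ∫ x : R3, phi u x * v x ^ 2

/-- `∫ V u² dx`. -/
def potentialTerm (V : R3 → ℝ) (u : L2) : ℝ :=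
  ∫ x : R3, V x * u x ^ 2

/-- A trapping potential: `V ∈ L^∞_loc(ℝ³)`, `V(x) → ∞` as `|x| → ∞`, and `inf V = 0`. -/
structure IsTrapping (V : R3 → ℝ) : Prop where
  locBounded : ∀ K : Set R3, IsCompact K → MemLp V ∞ (volume.restrict K)
  tendsto_atTop : Tendsto V (cocompact R3) atTop
  inf_eq_zero : IsGLB (Set.range V) 0

/-- The space `{u ∈ H^{1/2}(ℝ³) : ∫ V u² < ∞}`. -/
def trapSpace (V : R3 → ℝ) : Set L2 :=
  {u | MemHHalf u ∧ Integrable (fun x : R3 => V x * u x ^ 2)}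

/-- The constraint set `ℳ`. -/
def constraintSet (V₁ V₂ : R3 → ℝ) : Set (L2 × L2) :=
  {w | w.1 ∈ trapSpace V₁ ∧ w.2 ∈ trapSpace V₂ ∧
    ∫ x : R3, w.1 x ^ 2 = 1 ∧ ∫ x : R3, w.2 x ^ 2 = 1}

/-- The energy `E_{a₁,a₂,β}(u₁,u₂)`. -/
def energy (m : ℝ) (V₁ V₂ : R3 → ℝ) (a₁ a₂ β : ℝ) (w : L2 × L2) : ℝ :=
  (kinetic m w.1 + potentialTerm V₁ w.1) + (kinetic m w.2 + potentialTerm V₂ w.2)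
    - (a₁ / 2 * coulomb w.1 w.1 + a₂ / 2 * coulomb w.2 w.2)
    - β * coulomb w.1 w.2

/-- The infimum `ê(a₁,a₂,β)`, extended-real valued since it may be `-∞`. -/
def eHat (m : ℝ) (V₁ V₂ : R3 → ℝ) (a₁ a₂ β : ℝ) : EReal :=
  ⨅ w ∈ constraintSet V₁ V₂, (energy m V₁ V₂ a₁ a₂ β w : EReal)

/-- `w` is a minimizer of `ê(a₁,a₂,β)`: it is admissible and attains the infimum. -/
def IsMinimizer (m : ℝ) (V₁ V₂ : R3 → ℝ) (a₁ a₂ β : ℝ) (w : L2 × L2) : Prop :=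
  w ∈ constraintSet V₁ V₂ ∧ (energy m V₁ V₂ a₁ a₂ β w : EReal) = eHat m V₁ V₂ a₁ a₂ β

/-- The quotient `J_{a₁,a₂,β}(u₁,u₂)`. -/
def quotientJ (a₁ a₂ β : ℝ) (w : L2 × L2) : ℝ :=
  (2 * quarterLaplacianSq w.1 + 2 * quarterLaplacianSq w.2) /
    (a₁ * coulomb w.1 w.1 + a₂ * coulomb w.2 w.2 + 2 * max 0 β * coulomb w.1 w.2)

/-- The set of pairs of `L²`-normalized functions in `H^{1/2}(ℝ³)`. -/
def normalizedPairs : Set (L2 × L2) :=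
  {w | MemHHalf w.1 ∧ MemHHalf w.2 ∧
    ∫ x : R3, w.1 x ^ 2 = 1 ∧ ∫ x : R3, w.2 x ^ 2 = 1}

/-- The auxiliary infimum `η(a₁,a₂,β)`. -/
def eta (a₁ a₂ β : ℝ) : EReal :=
  ⨅ w ∈ normalizedPairs, (quotientJ a₁ a₂ β w : EReal)

end PseudoHartree

end

open MeasureTheory Filter
open scoped FourierTransform ENNReal

noncomputable section

namespace PseudoHartree

/-! The problem is mass-critical: under u ↦ t^{3/2}u(t·) the L² norm is unchanged, while
‖(-Δ)^{1/4}u‖₂² and the Coulomb energies are all multiplied by t. Their balance, which η compares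
with 1, therefore decides whether concentration pays.

If η > 1, pick 1 < q < η. The attractive interaction is at most 1/q times the massless kinetic
energy, hence at most 1/q times the true one, and the energy dominates (1 - 1/q) times its positive
part (`exists_coercivity`). Minimizing sequences are thus bounded in H^{1/2} with bounded potential
energy. Trapping makes such sets precompact in L² (`IsTrapping.exists_subseq_tendsto`); Fatou's
lemma handles the kinetic and potential terms, and the Coulomb terms converge (`tendsto_coulomb`).

If η < 1, a pair with quotient below 1 is truncated to compact support and dilated with t → ∞. The
potential terms stay bounded because the supports stay in a fixed ball, and the rest goes to -∞
linearly in t. For β ≥ 0 both components are concentrated. For β < 0 one component already wins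
alone, so the other is kept as a fixed bump, against which the repulsion stays bounded. The energy
is unbounded below, whereas a minimizer would have a real energy.

Two tools make this workable. The Fourier side is replaced by a double difference integral
(`gagliardo_eq`), which suits cutoffs, dilations and local averages. A fractional Hardy inequality
(`lintegral_sq_div_norm_sub_le`), proved by comparing f near x with f near 4x, bounds φ_u uniformly
by the H^{1/2} seminorm and so controls every Coulomb term. -/

/-! ### Translations under the Fourier transform -/

/-- Translation `f ↦ f (· + h)` on complex `L²(ℝ³)`. -/
def translateL2 (h : R3) : Lp ℂ 2 (volume : Measure R3) →ₗᵢ[ℂ] Lp ℂ 2 (volume : Measure R3) :=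
  Lp.compMeasurePreservingₗᵢ ℂ (fun x : R3 => x + h) (measurePreserving_add_right volume h)

theorem coeFn_translateL2 (h : R3) (f : Lp ℂ 2 (volume : Measure R3)) :
    translateL2 h f =ᵐ[volume] fun x => f (x + h) :=
  Lp.coeFn_compMeasurePreserving f (measurePreserving_add_right volume h)

/-- The phase `ξ ↦ exp(2πi h·ξ)`. -/
def phase (h ξ : R3) : ℂ := (Real.fourierChar (inner ℝ h ξ) : ℂ)

theorem continuous_phase (h : R3) : Continuous (phase h) := by
  unfold phase
  fun_prop

theorem norm_phase (h ξ : R3) : ‖phase h ξ‖ = 1 := Circle.norm_coe _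

theorem memLp_phase (h : R3) : MemLp (phase h) ∞ (volume : Measure R3) :=
  memLp_top_of_bound (continuous_phase h).aestronglyMeasurable 1
    (Eventually.of_forall fun ξ => (norm_phase h ξ).le)

/-- Multiplication by `phase h` on complex `L²(ℝ³)`. -/
def phaseL2 (h : R3) : Lp ℂ 2 (volume : Measure R3) →L[ℂ] Lp ℂ 2 (volume : Measure R3) :=
  (ContinuousLinearMap.mul ℂ ℂ).holderL volume ∞ 2 2 ((memLp_phase h).toLp _)

theorem coeFn_phaseL2 (h : R3) (f : Lp ℂ 2 (volume : Measure R3)) :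
    phaseL2 h f =ᵐ[volume] fun ξ => phase h ξ * f ξ := by
  have h1 := (ContinuousLinearMap.mul ℂ ℂ).coeFn_holder (r := 2) ((memLp_phase h).toLp _) f
  filter_upwards [h1, (memLp_phase h).coeFn_toLp] with ξ h1 h2
  rw [phaseL2, ContinuousLinearMap.holderL_apply_apply, h1, h2]
  rfl

/-- Both sides are continuous in `f`, so Schwartz functions suffice, and there it is a change of
variable in the Fourier integral. -/
theorem fourier_translateL2 (h : R3) (f : Lp ℂ 2 (volume : Measure R3)) :
    𝓕 (translateL2 h f) = phaseL2 h (𝓕 f) := by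
  refine DenseRange.induction_on
    (p := fun f : Lp ℂ 2 (volume : Measure R3) => 𝓕 (translateL2 h f) = phaseL2 h (𝓕 f))
    (SchwartzMap.denseRange_toLpCLM (p := 2) (F := ℂ) ENNReal.ofNat_ne_top) f ?_ ?_
  · apply isClosed_eq
    · exact (Lp.fourierTransformₗᵢ R3 ℂ).continuous.comp (translateL2 h).continuous
    · exact (phaseL2 h).continuous.comp (Lp.fourierTransformₗᵢ R3 ℂ).continuous
  · intro f
    rw [SchwartzMap.toLpCLM_apply]
    have h1 : translateL2 h (f.toLp 2) = (SchwartzMap.compSubConstCLM ℂ (-h) f).toLp 2 := by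
      ext1
      filter_upwards [coeFn_translateL2 h (f.toLp 2),
        (SchwartzMap.compSubConstCLM ℂ (-h) f).coeFn_toLp 2,
        (measurePreserving_add_right volume h).quasiMeasurePreserving.ae
          (f.coeFn_toLp 2 (volume : Measure R3))] with x h1 h2 h3
      rw [h1, h2, h3]
      simp
    rw [h1, SchwartzMap.toLp_fourier_eq, SchwartzMap.toLp_fourier_eq]
    ext1
    filter_upwards [coeFn_phaseL2 h ((𝓕 f).toLp 2), (𝓕 f).coeFn_toLp 2 (volume : Measure R3),
      (𝓕 (SchwartzMap.compSubConstCLM ℂ (-h) f)).coeFn_toLp 2 (volume : Measure R3)]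
      with ξ h1 h2 h3
    rw [h1, h2, h3, SchwartzMap.fourier_coe, SchwartzMap.fourier_coe]
    have h4 : (⇑(SchwartzMap.compSubConstCLM ℂ (-h) f) : R3 → ℂ) = ⇑f ∘ fun x => x + h := by
      ext x; simp
    rw [h4]
    have := congrFun (VectorFourier.fourierIntegral_comp_add_right Real.fourierChar
      (volume : Measure R3) (innerₗ R3) f h) ξ
    exact this

theorem lintegral_sq_norm_coeFn {F : Type*} [NormedAddCommGroup F]
    (g : Lp F 2 (volume : Measure R3)) :
    ∫⁻ x, ENNReal.ofReal (‖g x‖ ^ 2) = ENNReal.ofReal (‖g‖ ^ 2) := by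
  have h2 : ‖g‖ₑ = eLpNorm g 2 volume := Lp.enorm_def g
  rw [ENNReal.ofReal_pow (norm_nonneg _), ofReal_norm, h2,
    eLpNorm_eq_lintegral_rpow_enorm_toReal (by simp) (by simp), ← ENNReal.rpow_natCast,
    ← ENNReal.rpow_mul]
  have h3 : 1 / (2 : ℝ≥0∞).toReal * ((2 : ℕ) : ℝ) = 1 := by norm_num
  rw [h3, ENNReal.rpow_one]
  refine lintegral_congr fun x => ?_
  rw [ENNReal.ofReal_pow (norm_nonneg _), ofReal_norm, ← ENNReal.rpow_natCast]
  norm_num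

theorem coeFn_ofReal_compLp (u : L2) :
    Complex.ofRealCLM.compLp u =ᵐ[volume] fun x => (u x : ℂ) :=
  Complex.ofRealCLM.coeFn_compLp u

theorem norm_ofReal_compLp (u : L2) : ‖Complex.ofRealCLM.compLp u‖ = ‖u‖ := by
  refine le_antisymm (Lp.norm_le_norm_of_ae_le ?_) (Lp.norm_le_norm_of_ae_le ?_) <;>
  · filter_upwards [coeFn_ofReal_compLp u] with x hx
    simp [hx]

theorem norm_fourierL2 (u : L2) : ‖fourierL2 u‖ = ‖u‖ := by
  rw [fourierL2, Lp.norm_fourier_eq, norm_ofReal_compLp]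

/-- Plancherel's identity for the difference of a function and its translate. -/
theorem lintegral_sq_translate_sub (u : L2) (h : R3) :
    ∫⁻ x, ENNReal.ofReal ((u (x + h) - u x) ^ 2) =
      ∫⁻ ξ, ENNReal.ofReal (‖phase h ξ - 1‖ ^ 2 * ‖fourierL2 u ξ‖ ^ 2) := by
  set f := Complex.ofRealCLM.compLp u
  have h1 : ∫⁻ x, ENNReal.ofReal ((u (x + h) - u x) ^ 2) =
      ∫⁻ x, ENNReal.ofReal (‖(translateL2 h f - f) x‖ ^ 2) := by
    refine lintegral_congr_ae ?_
    filter_upwards [Lp.coeFn_sub (translateL2 h f) f, coeFn_translateL2 h f,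
      coeFn_ofReal_compLp u, (measurePreserving_add_right volume h).quasiMeasurePreserving.ae
          (coeFn_ofReal_compLp u)] with x h1 h2 h3 h4
    rw [h1, Pi.sub_apply, h2, h3, h4, ← Complex.ofReal_sub, Complex.norm_real, Real.norm_eq_abs,
      sq_abs]
  have h2 : 𝓕 (translateL2 h f - f) = phaseL2 h (𝓕 f) - 𝓕 f := by
    rw [← fourier_translateL2]
    exact (Lp.fourierTransformₗᵢ R3 ℂ).map_sub _ _
  rw [h1, lintegral_sq_norm_coeFn, ← Lp.norm_fourier_eq, h2, ← lintegral_sq_norm_coeFn]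
  refine lintegral_congr_ae ?_
  filter_upwards [Lp.coeFn_sub (phaseL2 h (𝓕 f)) (𝓕 f), coeFn_phaseL2 h (𝓕 f)] with ξ h1 h2
  rw [h1, Pi.sub_apply, h2, ← mul_pow, ← norm_mul, sub_mul, one_mul]
  rfl

/-! ### The Gagliardo energy and its Fourier symbol -/

theorem lintegral_comp_smul (f : R3 → ℝ≥0∞) {t : ℝ} (ht : 0 < t) :
    ∫⁻ x, f (t • x) = ENNReal.ofReal ((t ^ 3)⁻¹) * ∫⁻ x, f x := by
  have h := Measure.map_addHaar_smul (volume : Measure R3) ht.ne'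
  have h2 : ∫⁻ x, f x ∂(Measure.map (fun x : R3 => t • x) volume) = ∫⁻ x, f (t • x) :=
    lintegral_map_equiv f (Homeomorph.smulOfNeZero t ht.ne').toMeasurableEquiv
  rw [← h2]
  change ∫⁻ x, f x ∂(Measure.map (t • ·) volume) = _
  rw [h, lintegral_smul_measure, abs_of_pos (by positivity)]
  simp

/-- In polar coordinates the radial density is 1 near the origin and r⁻² at infinity. This is the
majorant behind the finiteness of the symbol and all the cutoff estimates. -/
theorem integrable_min_one_sq_div :
    Integrable (fun h : R3 => min 1 (‖h‖ ^ 2) / ‖h‖ ^ 4) := by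
  rw [integrable_fun_norm_addHaar (volume : Measure R3) (f := fun y => min 1 (y ^ 2) / y ^ 4)]
  have h3 : Module.finrank ℝ R3 - 1 = 2 := by simp
  rw [h3, ← Set.Ioc_union_Ioi_eq_Ioi zero_le_one]
  refine IntegrableOn.union ?_ ?_
  · refine (integrableOn_const (C := (1 : ℝ)) (by simp)).congr_fun ?_ measurableSet_Ioc
    intro y hy
    have hy0 : y ≠ 0 := hy.1.ne'
    have : y ^ 2 ≤ 1 := pow_le_one₀ hy.1.le hy.2
    simp only [min_eq_right this, smul_eq_mul]
    field_simp
  · have h := integrableOn_Ioi_rpow_of_lt (a := -2) (by norm_num) (zero_lt_one' ℝ)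
    refine h.congr_fun ?_ measurableSet_Ioi
    intro y hy
    have hy1 : (1 : ℝ) < y := hy
    have hy0 : 0 < y := by linarith
    have : 1 ≤ y ^ 2 := one_le_pow₀ hy1.le
    simp only [min_eq_left this, smul_eq_mul]
    rw [Real.rpow_neg hy0.le]
    norm_cast
    field_simp

/-- The Gagliardo energy `∬ |f(x+h) - f(x)|² |h|⁻⁴ dx dh`. -/
def gagliardo (f : R3 → ℝ) : ℝ≥0∞ :=
  ∫⁻ h, ∫⁻ x, ENNReal.ofReal ((f (x + h) - f x) ^ 2 / ‖h‖ ^ 4)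

/-- The Fourier symbol of the Gagliardo energy. -/
def gagliardoSymbol (ξ : R3) : ℝ≥0∞ :=
  ∫⁻ h, ENNReal.ofReal (‖phase h ξ - 1‖ ^ 2 / ‖h‖ ^ 4)

/-- The phase depends only on the product of `t` with h·ξ, so t can be moved onto h; the kernel then
contributes t⁴ and the volume t⁻³. -/
theorem gagliardoSymbol_smul (ξ : R3) {t : ℝ} (ht : 0 < t) :
    gagliardoSymbol (t • ξ) = ENNReal.ofReal t * gagliardoSymbol ξ := by
  have h : ∀ h : R3, ENNReal.ofReal (‖phase h (t • ξ) - 1‖ ^ 2 / ‖h‖ ^ 4) =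
      ENNReal.ofReal (t ^ 4) * ENNReal.ofReal (‖phase (t • h) ξ - 1‖ ^ 2 / ‖t • h‖ ^ 4) := by
    intro h
    rw [← ENNReal.ofReal_mul (by positivity)]
    have e : phase h (t • ξ) = phase (t • h) ξ := by
      simp [phase, inner_smul_left, inner_smul_right]
    rw [e, norm_smul, Real.norm_eq_abs, abs_of_pos ht, mul_pow]
    congr 1
    field_simp
  rw [gagliardoSymbol]
  simp_rw [h]
  rw [lintegral_const_mul' _ _ ENNReal.ofReal_ne_top,
    lintegral_comp_smul (fun h => ENNReal.ofReal (‖phase h ξ - 1‖ ^ 2 / ‖h‖ ^ 4)) ht,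
    ← mul_assoc, ← ENNReal.ofReal_mul (by positivity), gagliardoSymbol]
  congr 2
  field_simp

theorem gagliardoSymbol_map (A : R3 ≃ₗᵢ[ℝ] R3) (ξ : R3) :
    gagliardoSymbol (A ξ) = gagliardoSymbol ξ := by
  rw [gagliardoSymbol, ← (A.measurePreserving).lintegral_comp_emb
    A.toHomeomorph.measurableEmbedding, gagliardoSymbol]
  simp [phase]

/-- The reflection in the hyperplane orthogonal to ξ - η exchanges two vectors of equal length. -/
theorem gagliardoSymbol_eq_of_norm_eq {ξ η : R3} (h : ‖ξ‖ = ‖η‖) :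
    gagliardoSymbol ξ = gagliardoSymbol η := by
  rw [← gagliardoSymbol_map (Submodule.reflection (Submodule.span ℝ {ξ - η})ᗮ) ξ,
    Submodule.reflection_sub h]

/-- A fixed unit vector. -/
def unitVec : R3 := EuclideanSpace.single 0 1

theorem norm_unitVec : ‖unitVec‖ = 1 := by simp [unitVec]

/-- The ratio between the Gagliardo energy and `‖(-Δ)^{1/4} u‖₂²`. -/
def gagliardoConst : ℝ≥0∞ := gagliardoSymbol unitVec / ENNReal.ofReal (2 * Real.pi)

/-- Radial symmetry and homogeneity of degree one leave only a multiple of |ξ|; the factor 2π is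
split off to match the weight of `quarterLaplacianSq`. -/
theorem gagliardoSymbol_eq (ξ : R3) :
    gagliardoSymbol ξ = gagliardoConst * ENNReal.ofReal (2 * Real.pi * ‖ξ‖) := by
  rcases eq_or_ne ξ 0 with rfl | hξ
  · simp [gagliardoSymbol, phase]
  · have h0 : 0 < ‖ξ‖ := norm_pos_iff.2 hξ
    rw [gagliardoSymbol_eq_of_norm_eq (η := ‖ξ‖ • unitVec) (by simp [norm_smul, norm_unitVec]),
      gagliardoSymbol_smul _ h0, gagliardoConst,
      ENNReal.ofReal_mul (show 0 ≤ 2 * Real.pi by positivity), ← mul_assoc,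
      ENNReal.div_mul_cancel, mul_comm]
    · simp [Real.pi_pos]
    · exact ENNReal.ofReal_ne_top

theorem norm_phase_sub_one_le (h ξ : R3) : ‖phase h ξ - 1‖ ≤ 2 * Real.pi * (‖h‖ * ‖ξ‖) := by
  have h1 : phase h ξ = Complex.exp (Complex.I * ((2 * Real.pi * inner ℝ h ξ : ℝ) : ℂ)) := by
    rw [phase, Real.fourierChar_apply, mul_comm]
  rw [h1]
  refine (Real.norm_exp_I_mul_ofReal_sub_one_le).trans ?_
  rw [Real.norm_eq_abs, abs_mul, abs_of_pos (by positivity)]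
  gcongr
  exact abs_real_inner_le_norm h ξ

/-- For small h the phase differs from 1 by at most 2π|h|, and always by at most 2, so 4π²
min(1,|h|²)/|h|⁴ is a majorant. -/
theorem gagliardoConst_ne_top : gagliardoConst ≠ ∞ := by
  refine ENNReal.div_ne_top ?_ (by simp [Real.pi_pos])
  have h := (integrable_min_one_sq_div.const_mul (4 * Real.pi ^ 2)).lintegral_lt_top
  refine ne_top_of_le_ne_top h.ne (lintegral_mono fun x => ENNReal.ofReal_le_ofReal ?_)
  rw [mul_div_assoc']
  gcongr
  have h2 := norm_phase_sub_one_le x unitVec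
  have h3 : ‖phase x unitVec - 1‖ ≤ 2 := by
    refine (norm_sub_le _ _).trans ?_
    rw [norm_phase]; norm_num
  rw [norm_unitVec, mul_one] at h2
  rcases min_cases 1 (‖x‖ ^ 2) with ⟨h4, -⟩ | ⟨h4, -⟩ <;> rw [h4]
  · have := Real.pi_gt_three
    nlinarith [norm_nonneg (phase x unitVec - 1)]
  · calc _ ≤ (2 * Real.pi * ‖x‖) ^ 2 := by gcongr
      _ = _ := by ring

/-- The integrand is positive wherever the phase is not 1, an open set, which is nonempty because
half the unit vector has phase -1. -/
theorem gagliardoConst_ne_zero : gagliardoConst ≠ 0 := by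
  refine (ENNReal.div_pos ?_ ENNReal.ofReal_ne_top).ne'
  have hm : Measurable fun h : R3 => ENNReal.ofReal (‖phase h unitVec - 1‖ ^ 2 / ‖h‖ ^ 4) := by
    unfold phase
    have : Continuous fun h : R3 => (Real.fourierChar (inner ℝ h unitVec) : ℂ) := by fun_prop
    have := this.measurable
    fun_prop
  have hc : Continuous fun h : R3 => phase h unitVec := by unfold phase; fun_prop
  have ho : IsOpen {h : R3 | phase h unitVec ≠ 1} := isOpen_ne_fun hc continuous_const
  refine ((lintegral_pos_iff_support hm).2 ((ho.measure_pos volume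
    ⟨(1 / 2 : ℝ) • unitVec, ?_⟩).trans_le (measure_mono ?_))).ne'
  · simp only [Set.mem_ofPred_eq, phase, inner_smul_left, real_inner_self_eq_norm_sq, norm_unitVec,
      Real.fourierChar_apply]
    have : ((2 * Real.pi * ((starRingEnd ℝ) (1 / 2) * 1 ^ 2) : ℝ) : ℂ) * Complex.I
      = Real.pi * Complex.I := by
      simp
      ring
    rw [this, Complex.exp_pi_mul_I]
    norm_num
  · intro h hh
    have h0 : h ≠ 0 := by
      rintro rfl
      simp [phase] at hh
    have h1 : phase h unitVec - 1 ≠ 0 := sub_ne_zero.2 hh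
    simp only [Function.mem_support, ne_eq, ENNReal.ofReal_eq_zero, not_le]
    positivity

/-- Plancherel for each fixed h, then Tonelli: integrating in h first produces the symbol. -/
theorem gagliardo_eq (u : L2) : gagliardo u =
    gagliardoConst * ∫⁻ ξ, ENNReal.ofReal (2 * Real.pi * ‖ξ‖ * ‖fourierL2 u ξ‖ ^ 2) := by
  have hm : Measurable (fourierL2 u) := (Lp.stronglyMeasurable _).measurable
  have hp : Measurable fun p : R3 × R3 => phase p.1 p.2 := by
    unfold phase
    have : Continuous fun p : R3 × R3 => (Real.fourierChar (inner ℝ p.1 p.2) : ℂ) := by fun_prop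
    exact this.measurable
  calc gagliardo u = ∫⁻ h : R3, ∫⁻ ξ, ENNReal.ofReal
        (‖phase h ξ - 1‖ ^ 2 / ‖h‖ ^ 4 * ‖fourierL2 u ξ‖ ^ 2) := by
        refine lintegral_congr fun h => ?_
        simp_rw [div_eq_inv_mul, mul_assoc]
        simp_rw [ENNReal.ofReal_mul (show 0 ≤ (‖h‖ ^ 4)⁻¹ by positivity)]
        rw [lintegral_const_mul' _ _ ENNReal.ofReal_ne_top,
          lintegral_const_mul' _ _ ENNReal.ofReal_ne_top, lintegral_sq_translate_sub]
    _ = ∫⁻ ξ, ∫⁻ h : R3, ENNReal.ofReal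
        (‖phase h ξ - 1‖ ^ 2 / ‖h‖ ^ 4 * ‖fourierL2 u ξ‖ ^ 2) := by
        refine lintegral_lintegral_swap (Measurable.aemeasurable ?_)
        simp only [Function.uncurry_def]
        fun_prop
    _ = ∫⁻ ξ, gagliardoConst * ENNReal.ofReal (2 * Real.pi * ‖ξ‖ * ‖fourierL2 u ξ‖ ^ 2) := by
        refine lintegral_congr fun ξ => ?_
        have : ∀ h : R3, 0 ≤ ‖phase h ξ - 1‖ ^ 2 / ‖h‖ ^ 4 := fun h => by positivity
        simp_rw [ENNReal.ofReal_mul (this _)]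
        rw [lintegral_mul_const' _ _ ENNReal.ofReal_ne_top, ← gagliardoSymbol, gagliardoSymbol_eq,
          mul_assoc, ← ENNReal.ofReal_mul (by positivity)]
    _ = _ := lintegral_const_mul' _ _ gagliardoConst_ne_top

/-! ### H^{1/2} in terms of the Gagliardo energy -/

theorem aestronglyMeasurable_weight_fourierL2 (u : L2) {w : R3 → ℝ} (hw : Continuous w) :
    AEStronglyMeasurable (fun ξ => w ξ * ‖fourierL2 u ξ‖ ^ 2) := by
  have hm : Measurable (fourierL2 u) := (Lp.stronglyMeasurable _).measurable
  have := hw.measurable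
  exact (by fun_prop : Measurable fun ξ => w ξ * ‖fourierL2 u ξ‖ ^ 2).aestronglyMeasurable

theorem integrable_norm_sq_fourierL2 (u : L2) : Integrable fun ξ => ‖fourierL2 u ξ‖ ^ 2 :=
  (Lp.memLp (fourierL2 u)).integrable_norm_pow (by simp)

theorem integral_norm_sq_fourierL2 (u : L2) : ∫ ξ, ‖fourierL2 u ξ‖ ^ 2 = ‖u‖ ^ 2 := by
  rw [integral_eq_lintegral_of_nonneg_ae (Eventually.of_forall fun _ => by positivity)
    (integrable_norm_sq_fourierL2 u).aestronglyMeasurable, lintegral_sq_norm_coeFn,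
    norm_fourierL2, ENNReal.toReal_ofReal (by positivity)]

theorem memHHalf_iff_integrable (u : L2) : MemHHalf u ↔
    Integrable fun ξ => 2 * Real.pi * ‖ξ‖ * ‖fourierL2 u ξ‖ ^ 2 := by
  have h0 := integrable_norm_sq_fourierL2 u
  unfold MemHHalf
  simp_rw [add_mul, one_mul]
  exact ⟨fun h => by simpa [Pi.sub_def] using h.sub h0, fun h => h0.add h⟩

theorem memHHalf_iff_gagliardo (u : L2) : MemHHalf u ↔ gagliardo u < ∞ := by
  rw [memHHalf_iff_integrable, gagliardo_eq]
  rw [← lintegral_ofReal_ne_top_iff_integrable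
    (aestronglyMeasurable_weight_fourierL2 u (by fun_prop))
    (Eventually.of_forall fun ξ => by positivity)]
  rw [ENNReal.mul_lt_top_iff]
  simp [gagliardoConst_ne_zero, gagliardoConst_ne_top, lt_top_iff_ne_top]
  intro h
  rw [h]; simp

theorem quarterLaplacianSq_eq (u : L2) :
    quarterLaplacianSq u = (gagliardo u).toReal / gagliardoConst.toReal := by
  rw [gagliardo_eq, ENNReal.toReal_mul, quarterLaplacianSq,
    integral_eq_lintegral_of_nonneg_ae (Eventually.of_forall fun _ => by positivity)
    (aestronglyMeasurable_weight_fourierL2 u (by fun_prop)), mul_div_cancel_left₀]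
  exact (ENNReal.toReal_pos gagliardoConst_ne_zero gagliardoConst_ne_top).ne'

/-! ### The fractional Hardy inequality -/

/-- The volume of the unit ball of `ℝ³`. -/
def unitBallVol : ℝ≥0∞ := volume (Metric.ball (0 : R3) 1)

theorem unitBallVol_ne_top : unitBallVol ≠ ∞ := measure_ball_lt_top.ne

theorem unitBallVol_ne_zero : unitBallVol ≠ 0 := (Metric.measure_ball_pos _ _ one_pos).ne'

theorem volume_ball_R3 (x : R3) {r : ℝ} (hr : 0 ≤ r) :
    volume (Metric.ball x r) = ENNReal.ofReal (r ^ 3) * unitBallVol := by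
  rw [Measure.addHaar_ball _ _ hr, unitBallVol]
  simp

theorem gagliardo_swap {f : R3 → ℝ} (hf : Measurable f) :
    gagliardo f = ∫⁻ x, ∫⁻ y, ENNReal.ofReal ((f y - f x) ^ 2 / ‖y - x‖ ^ 4) := by
  rw [gagliardo, lintegral_lintegral_swap]
  · refine lintegral_congr fun x => ?_
    rw [← lintegral_add_left_eq_self
      (fun y => ENNReal.ofReal ((f y - f x) ^ 2 / ‖y - x‖ ^ 4)) x]
    simp
  · refine Measurable.aemeasurable ?_
    simp only [Function.uncurry_def]
    fun_prop

theorem gagliardo_comp_add {f : R3 → ℝ} (a : R3) :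
    gagliardo (fun x => f (x + a)) = gagliardo f := by
  unfold gagliardo
  refine lintegral_congr fun h => ?_
  rw [← lintegral_add_right_eq_self (fun x => ENNReal.ofReal ((f (x + h) - f x) ^ 2 / ‖h‖ ^ 4)) a]
  simp only [add_right_comm]

open Classical in
/-- The kernel comparing `f` at `x` with its values on the ball of center `4x` and radius `|x|`. -/
def hardyKernel (f : R3 → ℝ) (ε : ℝ) (x y : R3) : ℝ≥0∞ :=
  if ε < ‖x‖ ∧ ‖y - (4 : ℝ) • x‖ < ‖x‖ then ENNReal.ofReal (2 * f y ^ 2 / ‖x‖ ^ 4) else 0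

theorem measurable_hardyKernel {f : R3 → ℝ} (hf : Measurable f) (ε : ℝ) :
    Measurable (Function.uncurry (hardyKernel f ε)) := by
  have h1 : MeasurableSet {p : R3 × R3 | ε < ‖p.1‖} :=
    measurableSet_lt (by fun_prop) (by fun_prop)
  have h2 : MeasurableSet {p : R3 × R3 | ‖p.2 - (4 : ℝ) • p.1‖ < ‖p.1‖} :=
    measurableSet_lt (by fun_prop) (by fun_prop)
  exact Measurable.ite (h1.inter h2) (by fun_prop) measurable_const

theorem measurableSet_lt_norm (ε : ℝ) : MeasurableSet {x : R3 | ε < ‖x‖} :=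
  measurableSet_lt measurable_const measurable_norm

/-- f(x)²/|x| is spread over the ball of centre 4x and radius |x|, of volume proportional to |x|³,
and f(x)² ≤ 2f(y)² + 2(f(y)-f(x))² is applied there. Since |y-x| ≤ 4|x|, the difference term carries
2·4⁴ = 512. -/
theorem lintegral_truncated_le_hardyKernel (f : R3 → ℝ) {ε : ℝ} (hε : 0 < ε) :
    unitBallVol * ∫⁻ x in {x | ε < ‖x‖}, ENNReal.ofReal (f x ^ 2 / ‖x‖) ≤
      ∫⁻ x, ∫⁻ y, (hardyKernel f ε x y + ENNReal.ofReal 512 *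
        ENNReal.ofReal ((f y - f x) ^ 2 / ‖y - x‖ ^ 4)) := by
  have hS := measurableSet_lt_norm ε
  rw [← lintegral_const_mul' _ _ unitBallVol_ne_top, ← lintegral_indicator hS]
  refine lintegral_mono fun x => ?_
  by_cases hx : ε < ‖x‖
  · have hx0 : 0 < ‖x‖ := hε.trans hx
    rw [Set.indicator_of_mem (show x ∈ {x : R3 | ε < ‖x‖} from hx)]
    have e1 : unitBallVol * ENNReal.ofReal (f x ^ 2 / ‖x‖) =
        ∫⁻ y in Metric.ball ((4 : ℝ) • x) ‖x‖, ENNReal.ofReal (f x ^ 2 / ‖x‖ ^ 4) := by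
      rw [lintegral_const, Measure.restrict_apply_univ, volume_ball_R3 _ hx0.le, ← mul_assoc,
        ← ENNReal.ofReal_mul (by positivity), mul_comm]
      congr 2
      field_simp
    rw [e1, ← lintegral_indicator measurableSet_ball]
    refine lintegral_mono fun y => ?_
    by_cases hy : y ∈ Metric.ball ((4 : ℝ) • x) ‖x‖
    · rw [Set.indicator_of_mem hy]
      rw [mem_ball_iff_norm] at hy
      simp only [hardyKernel, hx, hy, and_self, if_true]
      rw [← ENNReal.ofReal_mul (by norm_num), ← ENNReal.ofReal_add (by positivity)
        (by positivity)]
      refine ENNReal.ofReal_le_ofReal ?_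
      have hyx : ‖y - x‖ ≤ 4 * ‖x‖ := by
        have : y - x = (y - (4 : ℝ) • x) + (3 : ℝ) • x := by module
        rw [this]
        refine (norm_add_le _ _).trans ?_
        rw [norm_smul]
        norm_num
        linarith
      have h2 : (f y - f x) ^ 2 / (256 * ‖x‖ ^ 4) ≤ (f y - f x) ^ 2 / ‖y - x‖ ^ 4 := by
        rcases eq_or_ne y x with rfl | hne
        · simp
        · have : 0 < ‖y - x‖ := norm_pos_iff.2 (sub_ne_zero.2 hne)
          gcongr
          calc ‖y - x‖ ^ 4 ≤ (4 * ‖x‖) ^ 4 := by gcongr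
            _ = _ := by ring
      calc f x ^ 2 / ‖x‖ ^ 4 ≤ (2 * f y ^ 2 + 2 * (f y - f x) ^ 2) / ‖x‖ ^ 4 := by
            gcongr
            nlinarith [sq_nonneg (2 * f y - f x)]
        _ = 2 * f y ^ 2 / ‖x‖ ^ 4 + 512 * ((f y - f x) ^ 2 / (256 * ‖x‖ ^ 4)) := by
            field_simp
            ring
        _ ≤ _ := by gcongr
    · rw [Set.indicator_of_notMem hy]
      exact zero_le
  · rw [Set.indicator_of_notMem (show x ∉ {x : R3 | ε < ‖x‖} from hx)]
    exact zero_le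

/-- Here comparing with points farther from the origin pays off. For fixed y the admissible x lie in
the ball of centre y/4 and radius |y|/12, and |y| ≤ 5|x| bounds the kernel by 2·625 f(y)²/|y|⁴. The
resulting factor 1250/1728 is below 1; moreover |y| ≥ 3|x| keeps y in the truncated region. -/
theorem lintegral_hardyKernel_le {f : R3 → ℝ} (hf : Measurable f) {ε : ℝ} (hε : 0 < ε) :
    ∫⁻ x, ∫⁻ y, hardyKernel f ε x y ≤ ENNReal.ofReal (1250 / 1728) *
        (unitBallVol * ∫⁻ x in {x | ε < ‖x‖}, ENNReal.ofReal (f x ^ 2 / ‖x‖)) := by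
  have hS := measurableSet_lt_norm ε
  have hA := measurable_hardyKernel hf ε
  rw [lintegral_lintegral_swap hA.aemeasurable,
    ← lintegral_const_mul' _ _ unitBallVol_ne_top, ← lintegral_const_mul' _ _
    ENNReal.ofReal_ne_top, ← lintegral_indicator hS]
  refine lintegral_mono fun y => ?_
  by_cases hy : ε < ‖y‖
  · have hy0 : 0 < ‖y‖ := hε.trans hy
    rw [Set.indicator_of_mem (show y ∈ {x : R3 | ε < ‖x‖} from hy)]
    have e1 : ENNReal.ofReal (1250 / 1728) * (unitBallVol * ENNReal.ofReal (f y ^ 2 / ‖y‖)) =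
        ∫⁻ x in Metric.ball ((1 / 4 : ℝ) • y) (‖y‖ / 12),
          ENNReal.ofReal (1250 * f y ^ 2 / ‖y‖ ^ 4) := by
      rw [lintegral_const, Measure.restrict_apply_univ, volume_ball_R3 _ (by positivity),
        mul_comm unitBallVol, ← mul_assoc, ← mul_assoc, ← ENNReal.ofReal_mul (by norm_num),
        ← ENNReal.ofReal_mul (by positivity)]
      congr 2
      field_simp
      ring
    rw [e1, ← lintegral_indicator measurableSet_ball]
    refine lintegral_mono fun x => ?_
    simp only [hardyKernel]
    split_ifs with hx
    · obtain ⟨hx1, hx2⟩ := hx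
      have hx0 : 0 < ‖x‖ := hε.trans hx1
      have b1 : ‖y‖ ≤ 5 * ‖x‖ := by
        have : y = (y - (4 : ℝ) • x) + (4 : ℝ) • x := by module
        rw [this]
        refine (norm_add_le _ _).trans ?_
        rw [norm_smul]
        norm_num
        linarith
      have b2 : 3 * ‖x‖ ≤ ‖y‖ := by
        have h4 : 4 * ‖x‖ = ‖y - (y - (4 : ℝ) • x)‖ := by
          rw [sub_sub_cancel, norm_smul]; norm_num
        have := norm_sub_le y (y - (4 : ℝ) • x)
        linarith
      have b3 : x ∈ Metric.ball ((1 / 4 : ℝ) • y) (‖y‖ / 12) := by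
        rw [mem_ball_iff_norm]
        have : x - (1 / 4 : ℝ) • y = (-(1 / 4) : ℝ) • (y - (4 : ℝ) • x) := by module
        rw [this, norm_smul]
        norm_num
        linarith
      rw [Set.indicator_of_mem b3]
      refine ENNReal.ofReal_le_ofReal ?_
      rw [div_le_div_iff₀ (by positivity) (by positivity)]
      have : ‖y‖ ^ 4 ≤ 625 * ‖x‖ ^ 4 := by
        calc ‖y‖ ^ 4 ≤ (5 * ‖x‖) ^ 4 := by gcongr
          _ = _ := by ring
      nlinarith [sq_nonneg (f y)]
    · exact zero_le
  · rw [Set.indicator_of_notMem (show y ∉ {x : R3 | ε < ‖x‖} from hy)]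
    refine (lintegral_eq_zero_of_ae_eq_zero (Eventually.of_forall fun x => ?_)).le
    simp only [hardyKernel, Pi.zero_apply, ite_eq_right_iff]
    rintro ⟨hx1, hx2⟩
    have h4 : 4 * ‖x‖ = ‖y - (y - (4 : ℝ) • x)‖ := by
      rw [sub_sub_cancel, norm_smul]; norm_num
    have := norm_sub_le y (y - (4 : ℝ) • x)
    exact absurd (by linarith) hy

theorem lintegral_truncated_hardy_aux {f : R3 → ℝ} (hf : Measurable f) {ε : ℝ} (hε : 0 < ε) :
    unitBallVol * ∫⁻ x in {x | ε < ‖x‖}, ENNReal.ofReal (f x ^ 2 / ‖x‖) ≤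
      ENNReal.ofReal (1250 / 1728) *
        (unitBallVol * ∫⁻ x in {x | ε < ‖x‖}, ENNReal.ofReal (f x ^ 2 / ‖x‖)) +
      512 * gagliardo f := by
  have hA := measurable_hardyKernel hf ε
  refine (lintegral_truncated_le_hardyKernel f hε).trans ?_
  have h3 : ∀ x, ∫⁻ y, (hardyKernel f ε x y + ENNReal.ofReal 512 *
        ENNReal.ofReal ((f y - f x) ^ 2 / ‖y - x‖ ^ 4)) = (∫⁻ y, hardyKernel f ε x y) +
        ENNReal.ofReal 512 * ∫⁻ y, ENNReal.ofReal ((f y - f x) ^ 2 / ‖y - x‖ ^ 4) := fun x => by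
    have hx : Measurable fun y => hardyKernel f ε x y := hA.of_uncurry_left
    rw [lintegral_add_left hx, lintegral_const_mul' _ _ ENNReal.ofReal_ne_top]
  have hI : Measurable fun x => ∫⁻ y, hardyKernel f ε x y := hA.lintegral_prod_right'
  simp_rw [h3]
  rw [lintegral_add_left hI, lintegral_const_mul' _ _ ENNReal.ofReal_ne_top, ← gagliardo_swap hf]
  refine add_le_add (lintegral_hardyKernel_le hf hε) (le_of_eq ?_)
  simp

/-- The constant in Hardy's inequality. -/
def hardyConst : ℝ≥0∞ := 2000 / unitBallVol

theorem hardyConst_ne_top : hardyConst ≠ ∞ :=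
  ENNReal.div_ne_top (by simp) unitBallVol_ne_zero

theorem lintegral_truncated_hardy {f : R3 → ℝ} (hf : Measurable f)
    (hf2 : ∫⁻ x, ENNReal.ofReal (f x ^ 2) ≠ ∞) {ε : ℝ} (hε : 0 < ε) :
    ∫⁻ x in {x | ε < ‖x‖}, ENNReal.ofReal (f x ^ 2 / ‖x‖) ≤ hardyConst * gagliardo f := by
  have h := lintegral_truncated_hardy_aux hf hε
  set N := ∫⁻ x in {x | ε < ‖x‖}, ENNReal.ofReal (f x ^ 2 / ‖x‖) with hN
  have hS : MeasurableSet {x : R3 | ε < ‖x‖} := measurableSet_lt measurable_const measurable_norm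
  -- Absorbing N into the left side needs N finite; this is the only role of the truncation at ε and
  -- of square integrability.
  have hNt : N ≠ ∞ := by
    have : N ≤ ENNReal.ofReal (1 / ε) * ∫⁻ x, ENNReal.ofReal (f x ^ 2) := by
      rw [← lintegral_const_mul' _ _ ENNReal.ofReal_ne_top]
      refine le_trans (setLIntegral_mono' hS fun x hx => ?_) (setLIntegral_le_lintegral _ _)
      rw [← ENNReal.ofReal_mul (by positivity)]
      refine ENNReal.ofReal_le_ofReal ?_
      have hx : ε < ‖x‖ := hx
      rw [one_div, div_eq_inv_mul]
      gcongr
    exact ne_top_of_le_ne_top (ENNReal.mul_ne_top ENNReal.ofReal_ne_top hf2) this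
  rcases eq_or_ne (gagliardo f) ∞ with hG | hG
  · rw [hG, ENNReal.mul_top]
    · exact le_top
    · exact (ENNReal.div_pos (by simp) unitBallVol_ne_top).ne'
  have hw := unitBallVol_ne_top
  have hw0 : 0 < unitBallVol.toReal := ENNReal.toReal_pos unitBallVol_ne_zero hw
  rw [hardyConst, ENNReal.mul_comm_div, mul_comm, ← ENNReal.toReal_le_toReal hNt
    (ENNReal.mul_ne_top (ENNReal.div_ne_top hG unitBallVol_ne_zero) (by simp))]
  have hwN := ENNReal.mul_ne_top hw hNt
  have h' := ENNReal.toReal_mono (by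
    exact ENNReal.add_ne_top.2 ⟨ENNReal.mul_ne_top ENNReal.ofReal_ne_top hwN,
      ENNReal.mul_ne_top (by simp) hG⟩) h
  rw [ENNReal.toReal_add (ENNReal.mul_ne_top ENNReal.ofReal_ne_top hwN)
    (ENNReal.mul_ne_top (by simp) hG)] at h'
  simp only [ENNReal.toReal_mul, ENNReal.toReal_div, ENNReal.toReal_ofNat] at h' ⊢
  rw [ENNReal.toReal_ofReal (by norm_num)] at h'
  rw [div_mul_eq_mul_div, le_div_iff₀ hw0]
  have := ENNReal.toReal_nonneg (a := gagliardo f)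
  -- After absorption the factor is 512 / (1 - 1250/1728) = 512·1728/478, which is less than 2000.
  nlinarith

/-- The fractional Hardy inequality centered at the origin. -/
theorem lintegral_sq_div_norm_le {f : R3 → ℝ} (hf : Measurable f)
    (hf2 : ∫⁻ x, ENNReal.ofReal (f x ^ 2) ≠ ∞) :
    ∫⁻ x, ENNReal.ofReal (f x ^ 2 / ‖x‖) ≤ hardyConst * gagliardo f := by
  have h1 : ∫⁻ x in ⋃ n : ℕ, {x : R3 | 1 / ((n : ℝ) + 1) < ‖x‖}, ENNReal.ofReal (f x ^ 2 / ‖x‖) =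
      ⨆ n : ℕ, ∫⁻ x in {x : R3 | 1 / ((n : ℝ) + 1) < ‖x‖}, ENNReal.ofReal (f x ^ 2 / ‖x‖) := by
    refine setLIntegral_iUnion_of_directed _ (Monotone.directed_le ?_)
    intro n k hnk x hx
    have hx : 1 / ((n : ℝ) + 1) < ‖x‖ := hx
    exact lt_of_le_of_lt (by gcongr) hx
  have h2 : (⋃ n : ℕ, {x : R3 | 1 / ((n : ℝ) + 1) < ‖x‖}) = {0}ᶜ := by
    ext x
    simp only [Set.mem_iUnion, Set.mem_compl_iff, Set.mem_singleton_iff]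
    constructor
    · rintro ⟨n, hn⟩ rfl
      have hn : 1 / ((n : ℝ) + 1) < ‖(0 : R3)‖ := hn
      rw [norm_zero] at hn
      exact absurd hn (not_lt.2 (by positivity))
    · intro hx
      exact exists_nat_one_div_lt (norm_pos_iff.2 hx)
  rw [h2, restrict_compl_singleton] at h1
  rw [h1]
  exact iSup_le fun n => lintegral_truncated_hardy hf hf2 (by positivity)

/-- The fractional Hardy inequality. -/
theorem lintegral_sq_div_norm_sub_le {f : R3 → ℝ} (hf : Measurable f)
    (hf2 : ∫⁻ x, ENNReal.ofReal (f x ^ 2) ≠ ∞) (a : R3) :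
    ∫⁻ x, ENNReal.ofReal (f x ^ 2 / ‖a - x‖) ≤ hardyConst * gagliardo f := by
  rw [← gagliardo_comp_add a, ← lintegral_add_right_eq_self _ a]
  refine le_trans (le_of_eq ?_)
    (lintegral_sq_div_norm_le (f := fun x => f (x + a)) (by fun_prop) ?_)
  · simp
  · rwa [lintegral_add_right_eq_self (fun x => ENNReal.ofReal (f x ^ 2)) a]

/-! ### Bounds and continuity for the Coulomb energy -/

theorem measurable_coeFn (u : L2) : Measurable u := (Lp.stronglyMeasurable u).measurable

theorem integrable_sq (u : L2) : Integrable fun x => u x ^ 2 := by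
  simpa using (Lp.memLp u).integrable_norm_pow (by simp)

theorem lintegral_sq_coeFn (u : L2) : ∫⁻ x, ENNReal.ofReal (u x ^ 2) = ENNReal.ofReal (‖u‖ ^ 2) := by
  simpa using lintegral_sq_norm_coeFn u

theorem integral_sq_coeFn (u : L2) : ∫ x, u x ^ 2 = ‖u‖ ^ 2 := by
  rw [integral_eq_lintegral_of_nonneg_ae (Eventually.of_forall fun _ => by positivity)
    (integrable_sq u).aestronglyMeasurable, lintegral_sq_coeFn,
    ENNReal.toReal_ofReal (by positivity)]

/-- The Coulomb potential of `f²` as an extended nonnegative number. -/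
def phiE (f : R3 → ℝ) (x : R3) : ℝ≥0∞ := ∫⁻ y, ENNReal.ofReal (f y ^ 2 / ‖x - y‖)

/-- The Coulomb energy of `f²` and `g²` as an extended nonnegative number. -/
def coulombE (f g : R3 → ℝ) : ℝ≥0∞ :=
  ∫⁻ x, ∫⁻ y, ENNReal.ofReal (f y ^ 2 / ‖x - y‖ * g x ^ 2)

theorem coulombE_eq_lintegral_phiE (f g : R3 → ℝ) :
    coulombE f g = ∫⁻ x, phiE f x * ENNReal.ofReal (g x ^ 2) := by
  refine lintegral_congr fun x => ?_
  have : ∀ y, 0 ≤ f y ^ 2 / ‖x - y‖ := fun y => by positivity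
  simp_rw [ENNReal.ofReal_mul (this _)]
  rw [lintegral_mul_const' _ _ ENNReal.ofReal_ne_top, phiE]

theorem measurable_phiE {f : R3 → ℝ} (hf : Measurable f) : Measurable (phiE f) := by
  have h : Measurable (Function.uncurry fun x y : R3 => ENNReal.ofReal (f y ^ 2 / ‖x - y‖)) := by
    simp only [Function.uncurry_def]
    fun_prop
  exact h.lintegral_prod_right'

theorem coulombE_comm {f g : R3 → ℝ} (hf : Measurable f) (hg : Measurable g) :
    coulombE f g = coulombE g f := by
  rw [coulombE, lintegral_lintegral_swap]
  · refine lintegral_congr fun x => lintegral_congr fun y => ?_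
    rw [norm_sub_rev]
    congr 1
    ring
  · refine Measurable.aemeasurable ?_
    simp only [Function.uncurry_def]
    fun_prop

theorem phiE_le (u : L2) (x : R3) : phiE u x ≤ hardyConst * gagliardo u :=
  lintegral_sq_div_norm_sub_le (measurable_coeFn u)
    (by rw [lintegral_sq_coeFn]; exact ENNReal.ofReal_ne_top) x

theorem coulombE_le (u v : L2) :
    coulombE u v ≤ hardyConst * gagliardo u * ENNReal.ofReal (‖v‖ ^ 2) := by
  rw [coulombE_eq_lintegral_phiE, ← lintegral_sq_coeFn, ← lintegral_const_mul]
  · exact lintegral_mono fun x => by gcongr; exact phiE_le u x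
  · have := measurable_coeFn v
    fun_prop

theorem coulombE_ne_top {u : L2} (hu : MemHHalf u) (v : L2) : coulombE u v ≠ ∞ :=
  ne_top_of_le_ne_top (ENNReal.mul_ne_top (ENNReal.mul_ne_top hardyConst_ne_top
    ((memHHalf_iff_gagliardo u).1 hu).ne) ENNReal.ofReal_ne_top) (coulombE_le u v)

theorem phi_eq_toReal (u : L2) (x : R3) : phi u x = (phiE u x).toReal := by
  have := measurable_coeFn u
  rw [phi, integral_eq_lintegral_of_nonneg_ae (Eventually.of_forall fun _ => by positivity)
    (Measurable.aestronglyMeasurable (by fun_prop)), phiE]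

theorem phi_nonneg (u : L2) (x : R3) : 0 ≤ phi u x := by
  rw [phi_eq_toReal]; exact ENNReal.toReal_nonneg

theorem measurable_phi (u : L2) : Measurable (phi u) := by
  have : phi u = fun x => (phiE u x).toReal := funext (phi_eq_toReal u)
  rw [this]
  exact (measurable_phiE (measurable_coeFn u)).ennreal_toReal

theorem phi_le {u : L2} (hu : MemHHalf u) (x : R3) :
    phi u x ≤ (hardyConst * gagliardo u).toReal := by
  rw [phi_eq_toReal]
  exact ENNReal.toReal_mono (ENNReal.mul_ne_top hardyConst_ne_top
    ((memHHalf_iff_gagliardo u).1 hu).ne) (phiE_le u x)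

/-- `phi` is a Bochner integral, with value 0 where the true potential is infinite. The Hardy bound
excludes such points for u in H^{1/2}, so Tonelli arguments on `coulombE` carry over. -/
theorem coulomb_eq_toReal {u : L2} (hu : MemHHalf u) (v : L2) :
    coulomb u v = (coulombE u v).toReal := by
  have h1 := measurable_phi u
  have h2 := measurable_coeFn v
  have h3 : ∀ x, 0 ≤ phi u x * v x ^ 2 := fun x => mul_nonneg (phi_nonneg u x) (by positivity)
  rw [coulomb, integral_eq_lintegral_of_nonneg_ae (Eventually.of_forall h3) (by fun_prop),
    coulombE_eq_lintegral_phiE]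
  congr 1
  refine lintegral_congr fun x => ?_
  rw [ENNReal.ofReal_mul (phi_nonneg u x), phi_eq_toReal, ENNReal.ofReal_toReal]
  exact ne_top_of_le_ne_top (ENNReal.mul_ne_top hardyConst_ne_top
    ((memHHalf_iff_gagliardo u).1 hu).ne) (phiE_le u x)

theorem coulomb_nonneg (u v : L2) : 0 ≤ coulomb u v :=
  integral_nonneg fun x => mul_nonneg (phi_nonneg u x) (by positivity)

theorem coulomb_comm {u v : L2} (hu : MemHHalf u) (hv : MemHHalf v) :
    coulomb u v = coulomb v u := by
  rw [coulomb_eq_toReal hu, coulomb_eq_toReal hv,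
    coulombE_comm (measurable_coeFn u) (measurable_coeFn v)]

theorem integrable_phi_mul_sq {u : L2} (hu : MemHHalf u) (v : L2) :
    Integrable fun x => phi u x * v x ^ 2 := by
  refine (integrable_sq v).bdd_mul (c := (hardyConst * gagliardo u).toReal)
    (measurable_phi u).aestronglyMeasurable (Eventually.of_forall fun x => ?_)
  rw [Real.norm_eq_abs, abs_of_nonneg (phi_nonneg u x)]
  exact phi_le hu x

theorem coulomb_le {u : L2} (hu : MemHHalf u) (v : L2) :
    coulomb u v ≤ (hardyConst * gagliardo u).toReal * ‖v‖ ^ 2 := by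
  rw [coulomb, ← integral_sq_coeFn, ← integral_const_mul]
  refine integral_mono (integrable_phi_mul_sq hu v) ((integrable_sq v).const_mul _) fun x => ?_
  exact mul_le_mul_of_nonneg_right (phi_le hu x) (by positivity)

/-- Since φ_u is bounded, the Coulomb energy is Lipschitz in the density of the second argument for
the L¹ norm; no regularity of `v` or `w` is needed. -/
theorem abs_coulomb_sub_le {u : L2} (hu : MemHHalf u) (v w : L2) :
    |coulomb u v - coulomb u w| ≤
      (hardyConst * gagliardo u).toReal * ∫ x, |v x ^ 2 - w x ^ 2| := by
  rw [coulomb, coulomb, ← integral_sub (integrable_phi_mul_sq hu v) (integrable_phi_mul_sq hu w),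
    ← integral_const_mul]
  refine (abs_integral_le_integral_abs).trans (integral_mono ?_ ?_ fun x => ?_)
  · exact ((integrable_phi_mul_sq hu v).sub (integrable_phi_mul_sq hu w)).abs
  · exact ((integrable_sq v).sub (integrable_sq w)).abs.const_mul _
  · simp only
    rw [← mul_sub, abs_mul, abs_of_nonneg (phi_nonneg u x)]
    exact mul_le_mul_of_nonneg_right (phi_le hu x) (abs_nonneg _)

/-- Cauchy–Schwarz applied to the factorization |v² - w²| = |v - w||v + w|. -/
theorem integral_abs_sq_sub_sq_le (v w : L2) :
    ∫ x, |v x ^ 2 - w x ^ 2| ≤ ‖v - w‖ * ‖v + w‖ := by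
  have h : ∫ x, |v x ^ 2 - w x ^ 2| = inner ℝ |v - w| |v + w| := by
    rw [L2.inner_def]
    refine integral_congr_ae ?_
    filter_upwards [Lp.coeFn_abs (v - w), Lp.coeFn_abs (v + w), Lp.coeFn_sub v w,
      Lp.coeFn_add v w] with x h1 h2 h3 h4
    rw [h1, h2, h3, h4]
    simp only [Pi.sub_apply, Pi.add_apply, RCLike.inner_apply, conj_trivial]
    rw [← abs_mul]
    congr 1
    ring
  rw [h]
  refine (real_inner_le_norm _ _).trans ?_
  rw [norm_abs_eq_norm, norm_abs_eq_norm]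

theorem tendsto_integral_abs_sq_sub_sq {v : ℕ → L2} {w : L2} (h : Tendsto v atTop (nhds w)) :
    Tendsto (fun n => ∫ x, |v n x ^ 2 - w x ^ 2|) atTop (nhds 0) := by
  have h1 : Tendsto (fun n => ‖v n - w‖ * ‖v n + w‖) atTop (nhds (‖w - w‖ * ‖w + w‖)) :=
    ((h.sub_const w).norm).mul ((h.add_const w).norm)
  rw [sub_self, norm_zero, zero_mul] at h1
  exact squeeze_zero (fun n => integral_nonneg fun x => abs_nonneg _)
    (fun n => integral_abs_sq_sub_sq_le (v n) w) h1

/-- The Coulomb energy is continuous along `L²`-convergent sequences bounded in `H^{1/2}`. -/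
theorem tendsto_coulomb {u v : ℕ → L2} {u₀ v₀ : L2} (hu : Tendsto u atTop (nhds u₀))
    (hv : Tendsto v atTop (nhds v₀)) {M : ℝ≥0∞} (hM : M ≠ ∞)
    (hGu : ∀ᶠ n in atTop, gagliardo (u n) ≤ M)
    (hu₀ : MemHHalf u₀) (hv₀ : MemHHalf v₀) :
    Tendsto (fun n => coulomb (u n) (v n)) atTop (nhds (coulomb u₀ v₀)) := by
  rw [tendsto_iff_norm_sub_tendsto_zero]
  have h1 := ((tendsto_integral_abs_sq_sub_sq hv).const_mul (hardyConst * M).toReal).add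
    ((tendsto_integral_abs_sq_sub_sq hu).const_mul (hardyConst * gagliardo v₀).toReal)
  rw [mul_zero, mul_zero, add_zero] at h1
  refine squeeze_zero' (Eventually.of_forall fun n => norm_nonneg _) ?_ h1
  filter_upwards [hGu] with n hn
  have hmem : MemHHalf (u n) := (memHHalf_iff_gagliardo _).2 (hn.trans_lt hM.lt_top)
  rw [Real.norm_eq_abs]
  -- One argument is changed at a time. The first change uses the uniform bound `M` on φ of `u n`;
  -- the second, after symmetry, uses only the fixed φ of `v₀`.
  refine (abs_sub_le _ (coulomb (u n) v₀) _).trans (add_le_add ?_ ?_)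
  · refine (abs_coulomb_sub_le hmem _ _).trans ?_
    refine mul_le_mul_of_nonneg_right ?_ (integral_nonneg fun x => abs_nonneg _)
    exact ENNReal.toReal_mono (ENNReal.mul_ne_top hardyConst_ne_top hM) (by gcongr)
  · rw [coulomb_comm hmem hv₀, coulomb_comm hu₀ hv₀]
    exact abs_coulomb_sub_le hv₀ _ _

/-- If the double integral vanished, either φ_u would vanish at some point, forcing u = 0 through
the positive kernel, or φ_u > 0 everywhere, forcing u² = 0 through the outer integral. -/
theorem coulomb_pos {u : L2} (hu : MemHHalf u) (h0 : u ≠ 0) : 0 < coulomb u u := by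
  rw [coulomb_eq_toReal hu]
  refine ENNReal.toReal_pos (fun h => h0 ?_) (coulombE_ne_top hu u)
  have hm := measurable_coeFn u
  have hp := measurable_phiE hm
  rw [Lp.eq_zero_iff_ae_eq_zero]
  rw [coulombE_eq_lintegral_phiE, lintegral_eq_zero_iff (by fun_prop)] at h
  by_cases hx : ∃ x, phiE u x = 0
  · obtain ⟨x, hx⟩ := hx
    rw [phiE, lintegral_eq_zero_iff (by fun_prop)] at hx
    filter_upwards [hx, Measure.ae_ne volume x] with y hy hne
    have hpos : 0 < ‖x - y‖ := norm_pos_iff.2 (sub_ne_zero.2 hne.symm)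
    simp only [Pi.zero_apply, ENNReal.ofReal_eq_zero] at hy ⊢
    rw [div_le_iff₀ hpos, zero_mul] at hy
    exact pow_eq_zero_iff (two_ne_zero) |>.1 (le_antisymm hy (sq_nonneg _))
  · push Not at hx
    filter_upwards [h] with x h
    simp only [Pi.zero_apply, mul_eq_zero, hx x, false_or, ENNReal.ofReal_eq_zero] at h ⊢
    exact pow_eq_zero_iff (two_ne_zero) |>.1 (le_antisymm h (sq_nonneg _))

/-! ### Compactness in L² from a trapping potential -/

theorem gagliardo_congr_ae {f g : R3 → ℝ} (h : f =ᵐ[volume] g) : gagliardo f = gagliardo g := by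
  refine lintegral_congr fun a => lintegral_congr_ae ?_
  filter_upwards [h, (measurePreserving_add_right volume a).quasiMeasurePreserving.ae h]
    with x h1 h2
  rw [h1, h2]

theorem gagliardo_sub_le {f g : R3 → ℝ} (hf : Measurable f) :
    gagliardo (fun x => f x - g x) ≤ 2 * gagliardo f + 2 * gagliardo g := by
  have h1 : ∀ h : R3, ∫⁻ x, ENNReal.ofReal (((f (x + h) - g (x + h)) - (f x - g x)) ^ 2 / ‖h‖ ^ 4) ≤
      2 * (∫⁻ x, ENNReal.ofReal ((f (x + h) - f x) ^ 2 / ‖h‖ ^ 4)) +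
      2 * ∫⁻ x, ENNReal.ofReal ((g (x + h) - g x) ^ 2 / ‖h‖ ^ 4) := by
    intro h
    rw [← lintegral_const_mul' _ _ (by simp), ← lintegral_const_mul' _ _ (by simp),
      ← lintegral_add_left (by fun_prop)]
    refine lintegral_mono fun x => ?_
    have e2 : (2 : ℝ≥0∞) = ENNReal.ofReal 2 := by simp
    simp only [e2]
    rw [← ENNReal.ofReal_mul (by positivity), ← ENNReal.ofReal_mul (by positivity), ← ENNReal.ofReal_add (by positivity) (by positivity)]
    refine ENNReal.ofReal_le_ofReal ?_
    rw [← mul_div_assoc, ← mul_div_assoc, ← add_div]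
    gcongr
    nlinarith [sq_nonneg ((f (x + h) - f x) + (g (x + h) - g x))]
  refine (lintegral_mono h1).trans (le_of_eq ?_)
  rw [lintegral_add_left, lintegral_const_mul' _ _ (by simp), lintegral_const_mul' _ _ (by simp)]
  · rfl
  · refine Measurable.const_mul ?_ _
    have : Measurable (Function.uncurry fun h x : R3 =>
        ENNReal.ofReal ((f (x + h) - f x) ^ 2 / ‖h‖ ^ 4)) := by
      simp only [Function.uncurry_def]
      fun_prop
    exact this.lintegral_prod_right'

theorem gagliardo_sub_coeFn_le (u v : L2) :
    gagliardo (u - v : L2) ≤ 2 * gagliardo u + 2 * gagliardo v := by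
  rw [gagliardo_congr_ae (Lp.coeFn_sub u v)]
  exact gagliardo_sub_le (measurable_coeFn u)

/-- Cauchy–Schwarz against the constant 1, read off from the nonnegativity of the variance of g
about its mean. -/
theorem sq_setIntegral_le {s : Set R3} (hs : volume s ≠ ∞) {g : R3 → ℝ}
    (hg : IntegrableOn g s) (hg2 : IntegrableOn (fun x => g x ^ 2) s) :
    (∫ x in s, g x) ^ 2 ≤ volume.real s * ∫ x in s, g x ^ 2 := by
  rcases eq_or_ne (volume.real s) 0 with h0 | h0
  · have : volume.restrict s = 0 := by
      rw [Measure.restrict_eq_zero]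
      exact (measureReal_eq_zero_iff hs).1 h0
    simp [this]
  have hpos : 0 < volume.real s := lt_of_le_of_ne measureReal_nonneg h0.symm
  set m := (∫ x in s, g x) / volume.real s with hm
  have hc : IntegrableOn (fun _ : R3 => m ^ 2) s := integrableOn_const hs
  have h1 : 0 ≤ ∫ x in s, (g x - m) ^ 2 := integral_nonneg fun x => sq_nonneg _
  have h2 : ∫ x in s, (g x - m) ^ 2 =
      (∫ x in s, g x ^ 2) - 2 * m * (∫ x in s, g x) + volume.real s * m ^ 2 := by
    have e : ∀ x, (g x - m) ^ 2 = (g x ^ 2 - 2 * m * g x) + m ^ 2 := fun x => by ring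
    simp_rw [e]
    have hs : IntegrableOn (fun x => g x ^ 2 - 2 * m * g x) s := hg2.sub (hg.const_mul _)
    rw [integral_add hs hc, integral_sub hg2 (hg.const_mul _),
      integral_const_mul, setIntegral_const, smul_eq_mul]
  rw [h2] at h1
  have h3 : ∫ x in s, g x = volume.real s * m := by rw [hm]; field_simp
  rw [h3] at h1 ⊢
  nlinarith

theorem integrableOn_coeFn (d : L2) {s : Set R3} (hs : volume s ≠ ∞) : IntegrableOn d s :=
  haveI : IsFiniteMeasure (volume.restrict s) := ⟨by simpa using hs.lt_top⟩
  ((Lp.memLp d).restrict s).integrable (by norm_num)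

/-- The value at x is its ball average plus an oscillation; on the ball |y-x| ≤ r, so the
oscillation is bounded by r⁴ times the Gagliardo density. -/
theorem sq_le_ball_average (d : L2) (x : R3) {r : ℝ} (hr : 0 < r) :
    ENNReal.ofReal (d x ^ 2) ≤
      ENNReal.ofReal (2 * r ^ 4 / volume.real (Metric.ball x r)) *
        (∫⁻ y, ENNReal.ofReal ((d y - d x) ^ 2 / ‖y - x‖ ^ 4)) +
      ENNReal.ofReal (2 / volume.real (Metric.ball x r) ^ 2) *
        ENNReal.ofReal ((∫ y in Metric.ball x r, d y) ^ 2) := by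
  have hB : volume (Metric.ball x r) ≠ ∞ := measure_ball_lt_top.ne
  set b := volume.real (Metric.ball x r) with hb
  have hb0 : 0 < b := ENNReal.toReal_pos (Metric.measure_ball_pos _ _ hr).ne' hB
  have hi := integrableOn_coeFn d hB
  have hc : ∀ c : ℝ, IntegrableOn (fun _ : R3 => c) (Metric.ball x r) := fun c =>
    integrableOn_const hB
  have hi2 : IntegrableOn (fun y => (d y - d x) ^ 2) (Metric.ball x r) := by
    have e : (fun y => (d y - d x) ^ 2) = fun y => (d y ^ 2 - 2 * d x * d y) + d x ^ 2 := by
      ext y; ring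
    rw [e]
    exact ((integrable_sq d).integrableOn.sub (hi.const_mul _)).add (hc _)
  have h1 := sq_setIntegral_le (g := fun y => d y - d x) hB (hi.sub (hc (d x))) hi2
  rw [show ∫ y in Metric.ball x r, (d y - d x) =
    (∫ y in Metric.ball x r, d y) - b * d x by
      rw [integral_sub hi (hc _), setIntegral_const, smul_eq_mul]] at h1
  set I := ∫ y in Metric.ball x r, d y
  set S := ∫ y in Metric.ball x r, (d y - d x) ^ 2 with hS
  have h2 : d x ^ 2 ≤ 2 / b * S + 2 / b ^ 2 * I ^ 2 := by
    rw [div_mul_eq_mul_div, div_mul_eq_mul_div, div_add_div _ _ hb0.ne' (by positivity),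
      le_div_iff₀ (by positivity)]
    have : (b * d x) ^ 2 ≤ 2 * (b * S) + 2 * I ^ 2 := by nlinarith [sq_nonneg (2 * I - b * d x)]
    nlinarith
  have hS0 : 0 ≤ S := integral_nonneg fun y => sq_nonneg _
  have h3 : ENNReal.ofReal S ≤ ENNReal.ofReal (r ^ 4) *
      ∫⁻ y, ENNReal.ofReal ((d y - d x) ^ 2 / ‖y - x‖ ^ 4) := by
    rw [hS, ofReal_integral_eq_lintegral_ofReal hi2 (Eventually.of_forall fun y => sq_nonneg _),
      ← lintegral_const_mul' _ _ ENNReal.ofReal_ne_top]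
    refine (setLIntegral_mono' measurableSet_ball fun y hy => ?_).trans
      (setLIntegral_le_lintegral _ _)
    rw [← ENNReal.ofReal_mul (by positivity)]
    refine ENNReal.ofReal_le_ofReal ?_
    rcases eq_or_ne y x with rfl | hne
    · simp
    · have hp : 0 < ‖y - x‖ := norm_pos_iff.2 (sub_ne_zero.2 hne)
      rw [mem_ball_iff_norm] at hy
      rw [mul_div_assoc', le_div_iff₀ (by positivity), mul_comm]
      gcongr
  calc ENNReal.ofReal (d x ^ 2) ≤ ENNReal.ofReal (2 / b * S + 2 / b ^ 2 * I ^ 2) :=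
        ENNReal.ofReal_le_ofReal h2
    _ = ENNReal.ofReal (2 / b) * ENNReal.ofReal S +
        ENNReal.ofReal (2 / b ^ 2) * ENNReal.ofReal (I ^ 2) := by
        rw [ENNReal.ofReal_add (by positivity) (by positivity), ENNReal.ofReal_mul (by positivity),
          ENNReal.ofReal_mul (by positivity)]
    _ ≤ ENNReal.ofReal (2 / b) * (ENNReal.ofReal (r ^ 4) *
        ∫⁻ y, ENNReal.ofReal ((d y - d x) ^ 2 / ‖y - x‖ ^ 4)) +
        ENNReal.ofReal (2 / b ^ 2) * ENNReal.ofReal (I ^ 2) := by gcongr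
    _ = _ := by
        rw [← mul_assoc, ← ENNReal.ofReal_mul (by positivity), div_mul_eq_mul_div]

theorem measurable_setIntegral_ball (d : L2) (r : ℝ) :
    Measurable fun x : R3 => ∫ y in Metric.ball x r, d y := by
  have hP : MeasurableSet {p : R3 × R3 | dist p.2 p.1 < r} :=
    measurableSet_lt (by fun_prop) (by fun_prop)
  have hd := measurable_coeFn d
  have h : StronglyMeasurable ({p : R3 × R3 | dist p.2 p.1 < r}.indicator fun p => d p.2) :=
    ((by fun_prop : Measurable fun p : R3 × R3 => d p.2).indicator hP).stronglyMeasurable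
  have h2 := h.integral_prod_right' (ν := (volume : Measure R3))
  convert h2.measurable using 2 with x
  rw [← integral_indicator measurableSet_ball]
  rfl

theorem volume_real_ball_R3 (x : R3) {r : ℝ} (hr : 0 ≤ r) :
    volume.real (Metric.ball x r) = r ^ 3 * unitBallVol.toReal := by
  rw [measureReal_def, volume_ball_R3 x hr, ENNReal.toReal_mul,
    ENNReal.toReal_ofReal (by positivity)]

/-- A Poincaré-type estimate: since r⁴/r³ = r, the oscillation is small with r, uniformly on sets of
bounded Gagliardo energy, and only ball averages at scale r remain. -/
theorem setLIntegral_sq_le_ball_average (d : L2) (s : Set R3) {r : ℝ} (hr : 0 < r) :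
    ∫⁻ x in s, ENNReal.ofReal (d x ^ 2) ≤
      ENNReal.ofReal (2 * r / unitBallVol.toReal) * gagliardo d +
      ENNReal.ofReal (2 / (r ^ 3 * unitBallVol.toReal) ^ 2) *
        ∫⁻ x in s, ENNReal.ofReal ((∫ y in Metric.ball x r, d y) ^ 2) := by
  have hw0 : 0 < unitBallVol.toReal := ENNReal.toReal_pos unitBallVol_ne_zero unitBallVol_ne_top
  have hm := measurable_setIntegral_ball d r
  refine (lintegral_mono fun x => sq_le_ball_average d x hr).trans ?_
  simp_rw [volume_real_ball_R3 _ hr.le]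
  rw [lintegral_add_right _ (by fun_prop), lintegral_const_mul' _ _ ENNReal.ofReal_ne_top,
    lintegral_const_mul' _ _ ENNReal.ofReal_ne_top]
  refine add_le_add (mul_le_mul' (le_of_eq ?_) ?_) le_rfl
  · congr 1
    field_simp
  · rw [gagliardo_swap (measurable_coeFn d)]
    exact setLIntegral_le_lintegral _ _

/-- Bounded sequences in `L²` have weakly convergent subsequences. -/
theorem exists_subseq_tendsto_inner {u : ℕ → L2} {C : ℝ} (hu : ∀ n, ‖u n‖ ≤ C) :
    ∃ (u₀ : L2) (φ : ℕ → ℕ), StrictMono φ ∧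
      ∀ v : L2, Tendsto (fun n => inner ℝ v (u (φ n))) atTop (nhds (inner ℝ v u₀)) := by
  -- This provides separability of L², on which sequential weak-* compactness of the dual ball
  -- rests.
  have : Fact ((2 : ℝ≥0∞) ≠ ∞) := ⟨by simp⟩
  have hc := WeakDual.isSeqCompact_closedBall ℝ L2 0 C
  let x : ℕ → WeakDual ℝ L2 := fun n => StrongDual.toWeakDual (InnerProductSpace.toDual ℝ L2 (u n))
  obtain ⟨l, -, φ, hφ, hl⟩ := hc (x := x) (fun n => by
    simp only [x, Set.mem_preimage]
    rw [mem_closedBall_zero_iff]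
    exact ((InnerProductSpace.toDual ℝ L2).norm_map (u n)).le.trans (hu n))
  refine ⟨(InnerProductSpace.toDual ℝ L2).symm (WeakDual.toStrongDual l), φ, hφ, fun v => ?_⟩
  have h1 := ((WeakDual.eval_continuous v).tendsto l).comp hl
  rw [real_inner_comm, InnerProductSpace.toDual_symm_apply]
  refine h1.congr fun n => ?_
  simp only [x, Function.comp_apply]
  rw [real_inner_comm]
  rfl

theorem IsTrapping.nonneg {V : R3 → ℝ} (hV : IsTrapping V) (x : R3) : 0 ≤ V x :=
  hV.inf_eq_zero.1 ⟨x, rfl⟩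

theorem IsTrapping.exists_radius {V : R3 → ℝ} (hV : IsTrapping V) (M : ℝ) :
    ∃ R : ℝ, ∀ x : R3, x ∉ Metric.closedBall (0 : R3) R → M ≤ V x := by
  have h := hV.tendsto_atTop.eventually_ge_atTop M
  obtain ⟨K, hK, hKV⟩ := mem_cocompact.1 h
  obtain ⟨R, hR⟩ := hK.isBounded.subset_closedBall 0
  exact ⟨R, fun x hx => hKV fun hxK => hx (hR hxK)⟩

theorem setLIntegral_tail_le {V : R3 → ℝ} {M : ℝ} (hM : 0 < M) {s : Set R3} (hs : MeasurableSet s)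
    (hV : ∀ x ∈ s, M ≤ V x) (f : R3 → ℝ) :
    ∫⁻ x in s, ENNReal.ofReal (f x ^ 2) ≤
      ENNReal.ofReal (1 / M) * ∫⁻ x, ENNReal.ofReal (V x * f x ^ 2) := by
  rw [← lintegral_const_mul' _ _ ENNReal.ofReal_ne_top]
  refine (setLIntegral_mono' hs fun x hx => ?_).trans (setLIntegral_le_lintegral _ _)
  rw [← ENNReal.ofReal_mul (by positivity)]
  refine ENNReal.ofReal_le_ofReal ?_
  rw [div_mul_eq_mul_div, one_mul, le_div_iff₀ hM, mul_comm]
  exact mul_le_mul_of_nonneg_right (hV x hx) (sq_nonneg _)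

/-- Ball averages of a weakly null sequence vanish in the local `L²` limit. -/
theorem tendsto_setLIntegral_sq_ball {d : ℕ → L2} {C : ℝ} (hC : ∀ n, ‖d n‖ ≤ C)
    (hd : ∀ v : L2, Tendsto (fun n => inner ℝ v (d n)) atTop (nhds 0)) (r : ℝ) (R : ℝ) :
    Tendsto (fun n => ∫⁻ x in Metric.closedBall (0 : R3) R,
      ENNReal.ofReal ((∫ y in Metric.ball x r, d n y) ^ 2)) atTop (nhds 0) := by
  -- A ball integral is an inner product with an indicator, so weak convergence makes it tend to 0
  -- at each x, with a bound independent of x.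
  have hin : ∀ (x : R3) (u : L2), ∫ y in Metric.ball x r, u y =
      inner ℝ (indicatorConstLp 2 (measurableSet_ball (x := x) (ε := r))
        measure_ball_lt_top.ne (1 : ℝ)) u := fun x u => (L2.inner_indicatorConstLp_one _ _ _).symm
  set b := volume.real (Metric.ball (0 : R3) r)
  have hnorm : ∀ x : R3, ‖indicatorConstLp 2 (measurableSet_ball (x := x) (ε := r))
        measure_ball_lt_top.ne (1 : ℝ)‖ = Real.sqrt b := fun x => by
    rw [norm_indicatorConstLp (by simp) (by simp), Real.sqrt_eq_rpow]
    simp only [norm_one, one_mul, ENNReal.toReal_ofNat, b, measureReal_def]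
    rw [Measure.addHaar_ball_center (volume : Measure R3) x]
  have h := tendsto_lintegral_of_dominated_convergence
    (μ := volume.restrict (Metric.closedBall (0 : R3) R))
    (F := fun n x => ENNReal.ofReal ((∫ y in Metric.ball x r, d n y) ^ 2)) (f := fun _ => 0)
    (fun _ => ENNReal.ofReal ((Real.sqrt b * C) ^ 2)) (fun n => ?_) (fun n => ?_) ?_ ?_
  · simpa using h
  · have := measurable_setIntegral_ball (d n) r
    fun_prop
  · refine Eventually.of_forall fun x => ENNReal.ofReal_le_ofReal ?_
    rw [hin, ← sq_abs]
    gcongr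
    refine (abs_real_inner_le_norm _ _).trans ?_
    rw [hnorm]
    exact mul_le_mul_of_nonneg_left (hC n) (Real.sqrt_nonneg _)
  · rw [lintegral_const]
    exact ENNReal.mul_ne_top ENNReal.ofReal_ne_top
      (by rw [Measure.restrict_apply_univ]; exact measure_closedBall_lt_top.ne)
  · refine Eventually.of_forall fun x => ?_
    simp_rw [hin]
    have := ENNReal.tendsto_ofReal ((hd (indicatorConstLp 2 (measurableSet_ball (x := x) (ε := r))
        measure_ball_lt_top.ne (1 : ℝ))).pow 2)
    simpa using this

/-- The distance splits into oscillation (small with r), tail (small where V ≥ M), and ball averages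
on a bounded region. The weak limit `w` enters only through ball averages, so no bound on its
Gagliardo or potential energy is required. -/
theorem lintegral_sq_sub_le {V : R3 → ℝ} {C M R r : ℝ} (hC : 0 ≤ C) (hM : 0 < M) (hr : 0 < r)
    (hVR : ∀ x : R3, x ∉ Metric.closedBall (0 : R3) R → M ≤ V x) (u v w : L2)
    (hGu : gagliardo u ≤ ENNReal.ofReal C) (hGv : gagliardo v ≤ ENNReal.ofReal C)
    (hVu : ∫⁻ x, ENNReal.ofReal (V x * u x ^ 2) ≤ ENNReal.ofReal C)
    (hVv : ∫⁻ x, ENNReal.ofReal (V x * v x ^ 2) ≤ ENNReal.ofReal C) :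
    ENNReal.ofReal (‖u - v‖ ^ 2) ≤
      ENNReal.ofReal (8 * C / unitBallVol.toReal * r) + ENNReal.ofReal (4 * C / M) +
      ENNReal.ofReal (4 / (r ^ 3 * unitBallVol.toReal) ^ 2) *
        ((∫⁻ x in Metric.closedBall (0 : R3) R,
          ENNReal.ofReal ((∫ y in Metric.ball x r, (u - w : L2) y) ^ 2)) +
        ∫⁻ x in Metric.closedBall (0 : R3) R,
          ENNReal.ofReal ((∫ y in Metric.ball x r, (v - w : L2) y) ^ 2)) := by
  have hw0 : 0 < unitBallVol.toReal := ENNReal.toReal_pos unitBallVol_ne_zero unitBallVol_ne_top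
  have hs : MeasurableSet (Metric.closedBall (0 : R3) R) := measurableSet_closedBall
  have e2 : (2 : ℝ≥0∞) = ENNReal.ofReal 2 := by simp
  have h1 : gagliardo (u - v : L2) ≤ ENNReal.ofReal (4 * C) := by
    refine (gagliardo_sub_coeFn_le u v).trans ?_
    calc 2 * gagliardo u + 2 * gagliardo v ≤ 2 * ENNReal.ofReal C + 2 * ENNReal.ofReal C := by
          gcongr
      _ = ENNReal.ofReal (4 * C) := by
          simp only [e2]
          rw [← ENNReal.ofReal_mul (by positivity), ← ENNReal.ofReal_add (by positivity)
            (by positivity)]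
          congr 1; ring
  have h2 : ∫⁻ x in (Metric.closedBall (0 : R3) R)ᶜ, ENNReal.ofReal ((u - v : L2) x ^ 2) ≤
      ENNReal.ofReal (4 * C / M) := by
    have hu := measurable_coeFn u
    calc ∫⁻ x in (Metric.closedBall (0 : R3) R)ᶜ, ENNReal.ofReal ((u - v : L2) x ^ 2)
        ≤ ∫⁻ x in (Metric.closedBall (0 : R3) R)ᶜ, (ENNReal.ofReal 2 * ENNReal.ofReal (u x ^ 2) +
          ENNReal.ofReal 2 * ENNReal.ofReal (v x ^ 2)) := by
          refine lintegral_mono_ae (ae_restrict_of_ae ?_)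
          filter_upwards [Lp.coeFn_sub u v] with x hx
          rw [hx, Pi.sub_apply, ← ENNReal.ofReal_mul (by positivity),
            ← ENNReal.ofReal_mul (by positivity), ← ENNReal.ofReal_add (by positivity)
            (by positivity)]
          exact ENNReal.ofReal_le_ofReal (by nlinarith [sq_nonneg (u x + v x)])
      _ ≤ ENNReal.ofReal 2 * (ENNReal.ofReal (1 / M) * ENNReal.ofReal C) +
          ENNReal.ofReal 2 * (ENNReal.ofReal (1 / M) * ENNReal.ofReal C) := by
          rw [lintegral_add_left (by fun_prop), lintegral_const_mul' _ _ ENNReal.ofReal_ne_top,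
            lintegral_const_mul' _ _ ENNReal.ofReal_ne_top]
          have t := fun f => setLIntegral_tail_le hM hs.compl hVR f
          gcongr
          · exact (t u).trans (by gcongr)
          · exact (t v).trans (by gcongr)
      _ = _ := by
          rw [← ENNReal.ofReal_mul (by positivity), ← ENNReal.ofReal_mul (by positivity),
            ← ENNReal.ofReal_add (by positivity) (by positivity)]
          congr 1; ring
  have h3 : ∫⁻ x in Metric.closedBall (0 : R3) R,
      ENNReal.ofReal ((∫ y in Metric.ball x r, (u - v : L2) y) ^ 2) ≤
      ENNReal.ofReal 2 * ((∫⁻ x in Metric.closedBall (0 : R3) R,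
          ENNReal.ofReal ((∫ y in Metric.ball x r, (u - w : L2) y) ^ 2)) +
        ∫⁻ x in Metric.closedBall (0 : R3) R,
          ENNReal.ofReal ((∫ y in Metric.ball x r, (v - w : L2) y) ^ 2)) := by
    have hm := measurable_setIntegral_ball (u - w) r
    rw [← lintegral_add_left (by fun_prop), ← lintegral_const_mul' _ _ ENNReal.ofReal_ne_top]
    refine lintegral_mono fun x => ?_
    have hB : volume (Metric.ball x r) ≠ ∞ := measure_ball_lt_top.ne
    have e : ∫ y in Metric.ball x r, (u - v : L2) y =
        (∫ y in Metric.ball x r, (u - w : L2) y) - ∫ y in Metric.ball x r, (v - w : L2) y := by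
      rw [← integral_sub (integrableOn_coeFn _ hB) (integrableOn_coeFn _ hB)]
      refine integral_congr_ae (ae_restrict_of_ae ?_)
      filter_upwards [Lp.coeFn_sub u v, Lp.coeFn_sub u w, Lp.coeFn_sub v w] with y h1 h2 h3
      rw [h1, h2, h3]
      simp
    rw [e, ← ENNReal.ofReal_add (by positivity) (by positivity),
      ← ENNReal.ofReal_mul (by positivity)]
    refine ENNReal.ofReal_le_ofReal ?_
    set a := ∫ y in Metric.ball x r, (u - w : L2) y
    set b := ∫ y in Metric.ball x r, (v - w : L2) y
    nlinarith [sq_nonneg (a + b)]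
  rw [← lintegral_sq_coeFn, ← lintegral_add_compl _ hs]
  have h4 := setLIntegral_sq_le_ball_average (u - v) (Metric.closedBall (0 : R3) R) hr
  calc _ ≤ (ENNReal.ofReal (2 * r / unitBallVol.toReal) * ENNReal.ofReal (4 * C) +
      ENNReal.ofReal (2 / (r ^ 3 * unitBallVol.toReal) ^ 2) * (ENNReal.ofReal 2 * _)) +
      ENNReal.ofReal (4 * C / M) := by
        refine add_le_add (h4.trans ?_) h2
        gcongr
    _ = _ := by
        rw [← ENNReal.ofReal_mul (by positivity), ← mul_assoc (ENNReal.ofReal _),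
          ← ENNReal.ofReal_mul (by positivity), add_right_comm]
        congr 3 <;> ring_nf

/-- The embedding of `{u ∈ H^{1/2} : ∫ V u² < ∞}` into `L²` is compact. -/
theorem IsTrapping.exists_subseq_tendsto {V : R3 → ℝ} (hV : IsTrapping V) {u : ℕ → L2} {C : ℝ}
    (hn : ∀ n, ‖u n‖ ≤ C) (hG : ∀ n, gagliardo (u n) ≤ ENNReal.ofReal C)
    (hVu : ∀ n, ∫⁻ x, ENNReal.ofReal (V x * u n x ^ 2) ≤ ENNReal.ofReal C) :
    ∃ (u₀ : L2) (φ : ℕ → ℕ), StrictMono φ ∧ Tendsto (fun n => u (φ n)) atTop (nhds u₀) := by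
  obtain ⟨w, φ, hφ, hw⟩ := exists_subseq_tendsto_inner hn
  have hC : 0 ≤ C := (norm_nonneg _).trans (hn 0)
  have hw0 : 0 < unitBallVol.toReal := ENNReal.toReal_pos unitBallVol_ne_zero unitBallVol_ne_top
  suffices CauchySeq fun n => u (φ n) by
    obtain ⟨u₀, hu₀⟩ := cauchySeq_tendsto_of_complete this
    exact ⟨u₀, φ, hφ, hu₀⟩
  rw [Metric.cauchySeq_iff]
  intro ε hε
  -- Oscillation and tail each cost at most δ and the two ball-average terms δ/2 each, for a total
  -- of 3δ < ε². The added 1 in `M` and `r` covers C = 0.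
  set δ := ε ^ 2 / 4 with hδ
  have hδ0 : 0 < δ := by positivity
  set M := (4 * C + 1) / δ with hM
  have hM0 : 0 < M := by positivity
  obtain ⟨R, hR⟩ := hV.exists_radius M
  set r := δ / (8 * C / unitBallVol.toReal + 1) with hr
  have hr0 : 0 < r := by positivity
  set A := ENNReal.ofReal (4 / (r ^ 3 * unitBallVol.toReal) ^ 2)
  set T : ℕ → ℝ≥0∞ := fun n => ∫⁻ x in Metric.closedBall (0 : R3) R,
    ENNReal.ofReal ((∫ y in Metric.ball x r, (u (φ n) - w : L2) y) ^ 2)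
  have hT : Tendsto T atTop (nhds 0) := by
    refine tendsto_setLIntegral_sq_ball (d := fun n => u (φ n) - w) (C := C + ‖w‖)
      (fun n => (norm_sub_le _ _).trans (by gcongr; exact hn _)) (fun v => ?_) r R
    have := (hw v).sub_const (inner ℝ v w)
    simpa [inner_sub_right] using this
  have hAT : Tendsto (fun n => A * T n) atTop (nhds 0) := by
    simpa using ENNReal.Tendsto.const_mul hT (Or.inr ENNReal.ofReal_ne_top)
  have hev := (ENNReal.tendsto_nhds_zero.1 hAT) (ENNReal.ofReal (δ / 2))
    (by simpa using hδ0)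
  obtain ⟨N, hN⟩ := eventually_atTop.1 hev
  refine ⟨N, fun n hn' k hk' => ?_⟩
  have key := lintegral_sq_sub_le hC hM0 hr0 hR (u (φ n)) (u (φ k)) w (hG _) (hG _) (hVu _) (hVu _)
  have b1 : 8 * C / unitBallVol.toReal * r ≤ δ := by
    rw [hr, mul_div_assoc', div_le_iff₀ (by positivity)]
    nlinarith
  have b2 : 4 * C / M ≤ δ := by
    rw [hM, div_div_eq_mul_div, div_le_iff₀ (by positivity)]
    nlinarith
  have b3 : ENNReal.ofReal (‖u (φ n) - u (φ k)‖ ^ 2) ≤ ENNReal.ofReal (3 * δ) := by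
    refine key.trans ?_
    rw [mul_add]
    calc _ ≤ ENNReal.ofReal δ + ENNReal.ofReal δ +
        (ENNReal.ofReal (δ / 2) + ENNReal.ofReal (δ / 2)) := by
          refine add_le_add (add_le_add (ENNReal.ofReal_le_ofReal b1)
            (ENNReal.ofReal_le_ofReal b2)) (add_le_add (hN n hn') (hN k hk'))
      _ = _ := by
          rw [← ENNReal.ofReal_add (by positivity) (by positivity),
            ← ENNReal.ofReal_add (by positivity) (by positivity),
            ← ENNReal.ofReal_add (by positivity) (by positivity)]
          congr 1; ring
  rw [ENNReal.ofReal_le_ofReal_iff (by positivity)] at b3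
  rw [dist_eq_norm]
  refine lt_of_pow_lt_pow_left₀ 2 hε.le (b3.trans_lt ?_)
  rw [hδ]
  nlinarith

/-! ### Lower semicontinuity of kinetic and potential energy -/

/-- Fatou's lemma for Bochner integrals of nonnegative functions with bounded integrals. -/
theorem integrable_and_integral_le_of_tendsto_ae {f : ℕ → R3 → ℝ} {g : R3 → ℝ} {C : ℝ}
    (hf0 : ∀ n x, 0 ≤ f n x) (hg0 : ∀ x, 0 ≤ g x) (hf : ∀ n, Integrable (f n))
    (hC : ∀ n, ∫ x, f n x ≤ C)
    (hlim : ∀ᵐ x, Tendsto (fun n => f n x) atTop (nhds (g x))) :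
    Integrable g ∧ ∀ ε > 0, ∀ᶠ n in atTop, ∫ x, g x ≤ (∫ x, f n x) + ε := by
  have hgm : AEStronglyMeasurable g :=
    aestronglyMeasurable_of_tendsto_ae atTop (fun n => (hf n).aestronglyMeasurable) hlim
  have hfn : ∀ n, ∫⁻ x, ENNReal.ofReal (f n x) = ENNReal.ofReal (∫ x, f n x) := fun n =>
    (ofReal_integral_eq_lintegral_ofReal (hf n) (Eventually.of_forall (hf0 n))).symm
  have hle : ∫⁻ x, ENNReal.ofReal (g x) ≤
      liminf (fun n => ENNReal.ofReal (∫ x, f n x)) atTop := by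
    calc ∫⁻ x, ENNReal.ofReal (g x)
        = ∫⁻ x, liminf (fun n => ENNReal.ofReal (f n x)) atTop := by
          refine lintegral_congr_ae ?_
          filter_upwards [hlim] with x hx
          exact (ENNReal.tendsto_ofReal hx).liminf_eq.symm
      _ ≤ liminf (fun n => ∫⁻ x, ENNReal.ofReal (f n x)) atTop :=
          lintegral_liminf_le' fun n => (hf n).aestronglyMeasurable.aemeasurable.ennreal_ofReal
      _ = _ := by simp_rw [hfn]
  have hb : liminf (fun n => ENNReal.ofReal (∫ x, f n x)) atTop ≤ ENNReal.ofReal C :=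
    liminf_le_of_le (by isBoundedDefault) fun b hb => by
      obtain ⟨n, hn⟩ := hb.exists
      exact hn.trans (ENNReal.ofReal_le_ofReal (hC n))
  have hint : Integrable g :=
    (lintegral_ofReal_ne_top_iff_integrable hgm (Eventually.of_forall hg0)).1
      (ne_top_of_le_ne_top ENNReal.ofReal_ne_top (hle.trans hb))
  refine ⟨hint, fun ε hε => ?_⟩
  rw [← ofReal_integral_eq_lintegral_ofReal hint (Eventually.of_forall hg0)] at hle
  -- `ENNReal.ofReal` flattens negative numbers to 0, so subtracting ε is strict only when the limit
  -- integral exceeds ε; otherwise nonnegativity suffices.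
  by_cases hs : (∫ x, g x) ≤ ε
  · exact Eventually.of_forall fun n => hs.trans (le_add_of_nonneg_left
      (integral_nonneg (hf0 n)))
  · push Not at hs
    have hlt : ENNReal.ofReal ((∫ x, g x) - ε) < ENNReal.ofReal (∫ x, g x) :=
      (ENNReal.ofReal_lt_ofReal_iff (by linarith)).2 (by linarith)
    have := eventually_lt_of_lt_liminf (hlt.trans_le hle)
    filter_upwards [this] with n hn
    rw [ENNReal.ofReal_lt_ofReal_iff_of_nonneg (by linarith)] at hn
    linarith

theorem kinetic_integrand_le {m : ℝ} (hm : 0 ≤ m) (ξ : R3) :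
    Real.sqrt ((2 * Real.pi * ‖ξ‖) ^ 2 + m ^ 2) ≤ 2 * Real.pi * ‖ξ‖ + m := by
  have : 0 ≤ 2 * Real.pi * ‖ξ‖ := by positivity
  exact Real.sqrt_le_iff.2 ⟨by positivity, by nlinarith⟩

theorem le_kinetic_integrand (m : ℝ) (ξ : R3) :
    2 * Real.pi * ‖ξ‖ ≤ Real.sqrt ((2 * Real.pi * ‖ξ‖) ^ 2 + m ^ 2) :=
  Real.le_sqrt_of_sq_le (by nlinarith [sq_nonneg m])

theorem integrable_kinetic_iff {m : ℝ} (hm : 0 ≤ m) (u : L2) :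
    (Integrable fun ξ => Real.sqrt ((2 * Real.pi * ‖ξ‖) ^ 2 + m ^ 2) * ‖fourierL2 u ξ‖ ^ 2) ↔
      MemHHalf u := by
  rw [memHHalf_iff_integrable]
  constructor
  · intro h
    refine h.mono' (aestronglyMeasurable_weight_fourierL2 u (by fun_prop))
      (Eventually.of_forall fun ξ => ?_)
    rw [Real.norm_eq_abs, abs_of_nonneg (by positivity)]
    exact mul_le_mul_of_nonneg_right (le_kinetic_integrand m ξ) (by positivity)
  · intro h
    refine (h.add ((integrable_norm_sq_fourierL2 u).const_mul m)).mono'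
      (aestronglyMeasurable_weight_fourierL2 u (by fun_prop)) (Eventually.of_forall fun ξ => ?_)
    rw [Real.norm_eq_abs, abs_of_nonneg (by positivity), Pi.add_apply, ← add_mul]
    exact mul_le_mul_of_nonneg_right (kinetic_integrand_le hm ξ) (by positivity)

theorem quarterLaplacianSq_le_kinetic {m : ℝ} (hm : 0 ≤ m) {u : L2} (hu : MemHHalf u) :
    quarterLaplacianSq u ≤ kinetic m u :=
  integral_mono ((memHHalf_iff_integrable u).1 hu) ((integrable_kinetic_iff hm u).2 hu) fun ξ =>
    mul_le_mul_of_nonneg_right (le_kinetic_integrand m ξ) (by positivity)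

theorem kinetic_le {m : ℝ} (hm : 0 ≤ m) {u : L2} (hu : MemHHalf u) :
    kinetic m u ≤ quarterLaplacianSq u + m * ‖u‖ ^ 2 := by
  have h1 := (memHHalf_iff_integrable u).1 hu
  have h2 := (integrable_norm_sq_fourierL2 u).const_mul m
  rw [← integral_norm_sq_fourierL2, ← integral_const_mul, quarterLaplacianSq, ← integral_add h1 h2]
  refine integral_mono ((integrable_kinetic_iff hm u).2 hu) (h1.add h2) fun ξ => ?_
  simp only [← add_mul]
  exact mul_le_mul_of_nonneg_right (kinetic_integrand_le hm ξ) (by positivity)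

theorem kinetic_nonneg (m : ℝ) (u : L2) : 0 ≤ kinetic m u :=
  integral_nonneg fun ξ => by positivity

theorem IsTrapping.potentialTerm_nonneg {V : R3 → ℝ} (hV : IsTrapping V) (u : L2) :
    0 ≤ potentialTerm V u :=
  integral_nonneg fun x => mul_nonneg (hV.nonneg x) (sq_nonneg _)

theorem gagliardoConst_toReal_pos : 0 < gagliardoConst.toReal :=
  ENNReal.toReal_pos gagliardoConst_ne_zero gagliardoConst_ne_top

theorem gagliardo_eq_ofReal {u : L2} (hu : MemHHalf u) :
    gagliardo u = ENNReal.ofReal (gagliardoConst.toReal * quarterLaplacianSq u) := by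
  rw [quarterLaplacianSq_eq, mul_div_cancel₀ _ gagliardoConst_toReal_pos.ne',
    ENNReal.ofReal_toReal ((memHHalf_iff_gagliardo u).1 hu).ne]

theorem exists_subseq_tendsto_ae {F : Type*} [NormedAddCommGroup F]
    {u : ℕ → Lp F 2 (volume : Measure R3)} {u₀ : Lp F 2 (volume : Measure R3)}
    (h : Tendsto u atTop (nhds u₀)) :
    ∃ φ : ℕ → ℕ, StrictMono φ ∧ ∀ᵐ x, Tendsto (fun n => u (φ n) x) atTop (nhds (u₀ x)) :=
  (tendstoInMeasure_of_tendsto_Lp h).exists_seq_tendsto_ae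

theorem continuous_fourierL2 : Continuous fourierL2 :=
  (Lp.fourierTransformₗᵢ R3 ℂ).continuous.comp
    (ContinuousLinearMap.compLpL 2 volume Complex.ofRealCLM).continuous

/-- Compactness and weak lower semicontinuity for one component. -/
theorem IsTrapping.exists_subseq_tendsto_lsc {V : R3 → ℝ} (hV : IsTrapping V) {m : ℝ} (hm : 0 ≤ m)
    {u : ℕ → L2} {C : ℝ} (hu : ∀ n, u n ∈ trapSpace V) (hn : ∀ n, ‖u n‖ = 1)
    (hC : ∀ n, kinetic m (u n) + potentialTerm V (u n) ≤ C) :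
    ∃ (u₀ : L2) (φ : ℕ → ℕ), StrictMono φ ∧ Tendsto (fun n => u (φ n)) atTop (nhds u₀) ∧
      u₀ ∈ trapSpace V ∧ ‖u₀‖ = 1 ∧
      ∀ ε > 0, ∀ᶠ n in atTop, kinetic m u₀ + potentialTerm V u₀ ≤
        kinetic m (u (φ n)) + potentialTerm V (u (φ n)) + ε := by
  have hK : ∀ n, kinetic m (u n) ≤ C := fun n => by
    linarith [hC n, hV.potentialTerm_nonneg (u n)]
  have hP : ∀ n, potentialTerm V (u n) ≤ C := fun n => by
    linarith [hC n, kinetic_nonneg m (u n)]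
  have hC0 : 0 ≤ C := (kinetic_nonneg m _).trans (hK 0)
  have hc := gagliardoConst_toReal_pos
  -- One constant serves three bounds: 1 for the norm, `C` for the potential term, and
  -- `gagliardoConst.toReal * C` for the Gagliardo energy.
  obtain ⟨u₀, φ, hφ, hlim⟩ := hV.exists_subseq_tendsto (u := u)
    (C := 1 + C + gagliardoConst.toReal * C) (fun n => by rw [hn]; nlinarith) (fun n => by
      rw [gagliardo_eq_ofReal (hu n).1]
      refine ENNReal.ofReal_le_ofReal ?_
      have := (quarterLaplacianSq_le_kinetic hm (hu n).1).trans (hK n)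
      nlinarith) (fun n => by
      rw [← ofReal_integral_eq_lintegral_ofReal (hu n).2
        (Eventually.of_forall fun x => mul_nonneg (hV.nonneg x) (sq_nonneg _))]
      refine ENNReal.ofReal_le_ofReal ((hP n).trans ?_)
      nlinarith)
  obtain ⟨ψ, hψ, hae⟩ := exists_subseq_tendsto_ae hlim
  have hlim2 := hlim.comp hψ.tendsto_atTop
  -- Fatou is applied on both sides of the Fourier transform, so almost-everywhere convergence is
  -- also extracted for the transforms.
  obtain ⟨χ, hχ, haeF⟩ := exists_subseq_tendsto_ae ((continuous_fourierL2.tendsto u₀).comp hlim2)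
  have hlim3 := hlim2.comp hχ.tendsto_atTop
  set θ : ℕ → ℕ := fun n => φ (ψ (χ n)) with hθ
  have hae' : ∀ᵐ x, Tendsto (fun n => u (θ n) x) atTop (nhds (u₀ x)) := by
    filter_upwards [hae] with x hx
    exact hx.comp hχ.tendsto_atTop
  obtain ⟨i1, l1⟩ := integrable_and_integral_le_of_tendsto_ae
    (f := fun n ξ => Real.sqrt ((2 * Real.pi * ‖ξ‖) ^ 2 + m ^ 2) * ‖fourierL2 (u (θ n)) ξ‖ ^ 2)
    (g := fun ξ => Real.sqrt ((2 * Real.pi * ‖ξ‖) ^ 2 + m ^ 2) * ‖fourierL2 u₀ ξ‖ ^ 2) (C := C)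
    (fun n ξ => by positivity) (fun ξ => by positivity)
    (fun n => (integrable_kinetic_iff hm _).2 (hu _).1) (fun n => hK _) (by
      filter_upwards [haeF] with ξ hξ
      exact (hξ.norm.pow 2).const_mul _)
  obtain ⟨i2, l2⟩ := integrable_and_integral_le_of_tendsto_ae
    (f := fun n x => V x * u (θ n) x ^ 2) (g := fun x => V x * u₀ x ^ 2) (C := C)
    (fun n x => mul_nonneg (hV.nonneg x) (sq_nonneg _))
    (fun x => mul_nonneg (hV.nonneg x) (sq_nonneg _))
    (fun n => (hu _).2) (fun n => hP _) (by
      filter_upwards [hae'] with x hx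
      exact (hx.pow 2).const_mul _)
  refine ⟨u₀, θ, hφ.comp (hψ.comp hχ), hlim3, ⟨(integrable_kinetic_iff hm u₀).1 i1, i2⟩, ?_, ?_⟩
  · refine tendsto_nhds_unique hlim3.norm ?_
    simp [hn]
  · intro ε hε
    filter_upwards [l1 (ε / 2) (by positivity), l2 (ε / 2) (by positivity)] with n h1 h2
    have h1 : kinetic m u₀ ≤ kinetic m (u (θ n)) + ε / 2 := h1
    have h2 : potentialTerm V u₀ ≤ potentialTerm V (u (θ n)) + ε / 2 := h2
    linarith

/-! ### Coercivity and existence of a minimizer when η > 1 -/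

theorem integral_sq_eq_one_iff (u : L2) : ∫ x, u x ^ 2 = 1 ↔ ‖u‖ = 1 := by
  rw [integral_sq_coeFn]
  exact pow_eq_one_iff_of_nonneg (norm_nonneg u) two_ne_zero

theorem constraintSet_subset_normalizedPairs {V₁ V₂ : R3 → ℝ} {w : L2 × L2}
    (hw : w ∈ constraintSet V₁ V₂) : w ∈ normalizedPairs :=
  ⟨hw.1.1, hw.2.1.1, hw.2.2.1, hw.2.2.2⟩

/-- The sum of the kinetic and potential energies. -/
def positiveEnergy (m : ℝ) (V₁ V₂ : R3 → ℝ) (w : L2 × L2) : ℝ :=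
  (kinetic m w.1 + potentialTerm V₁ w.1) + (kinetic m w.2 + potentialTerm V₂ w.2)

/-- With 1 < q < η, every admissible pair has half the denominator of the quotient at most 1/q times
the kinetic energy. Replacing β by β⁺ only lowers the energy, so c = 1 - 1/q works. -/
theorem exists_coercivity {m : ℝ} (hm : 0 ≤ m) {V₁ V₂ : R3 → ℝ} (hV₁ : IsTrapping V₁)
    (hV₂ : IsTrapping V₂) {a₁ a₂ β : ℝ} (ha₁ : 0 < a₁) (ha₂ : 0 < a₂) (hη : 1 < eta a₁ a₂ β) :
    ∃ c > 0, ∀ w ∈ constraintSet V₁ V₂,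
      c * positiveEnergy m V₁ V₂ w ≤ energy m V₁ V₂ a₁ a₂ β w := by
  obtain ⟨q, hq1, hqη⟩ := EReal.lt_iff_exists_real_btwn.1 hη
  have hq1 : 1 < q := by exact_mod_cast hq1
  have hq0 : 0 < q := by linarith
  refine ⟨1 - 1 / q, sub_pos.2 ((div_lt_one hq0).2 hq1), fun w hw => ?_⟩
  have hJ : q < quotientJ a₁ a₂ β w := by
    have : (q : EReal) < (quotientJ a₁ a₂ β w : EReal) :=
      hqη.trans_le (iInf₂_le w (constraintSet_subset_normalizedPairs hw))
    exact_mod_cast this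
  have c11 := coulomb_nonneg w.1 w.1
  have c22 := coulomb_nonneg w.2 w.2
  have c12 := coulomb_nonneg w.1 w.2
  have hβ0 : 0 ≤ max 0 β := le_max_left _ _
  have hβ : β ≤ max 0 β := le_max_right _ _
  set D := a₁ * coulomb w.1 w.1 + a₂ * coulomb w.2 w.2 + 2 * max 0 β * coulomb w.1 w.2 with hD
  have hD0 : 0 ≤ D := by positivity
  -- Division by zero gives 0, so a quotient above q > 1 rules out a vanishing denominator.
  have hDpos : 0 < D := by
    refine lt_of_le_of_ne hD0 fun h => ?_
    rw [quotientJ, ← hD, ← h, div_zero] at hJ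
    linarith
  rw [quotientJ, ← hD, lt_div_iff₀ hDpos] at hJ
  have k1 := quarterLaplacianSq_le_kinetic hm hw.1.1
  have k2 := quarterLaplacianSq_le_kinetic hm hw.2.1.1
  have p1 := hV₁.potentialTerm_nonneg w.1
  have p2 := hV₂.potentialTerm_nonneg w.2
  have hE : positiveEnergy m V₁ V₂ w - D / 2 ≤ energy m V₁ V₂ a₁ a₂ β w := by
    rw [energy, positiveEnergy, hD]
    nlinarith [mul_le_mul_of_nonneg_right hβ c12]
  have hD2 : D / 2 ≤ 1 / q * positiveEnergy m V₁ V₂ w := by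
    rw [one_div, ← div_eq_inv_mul, le_div_iff₀ hq0, positiveEnergy]
    linarith
  linarith

theorem exists_isMinimizer {m : ℝ} (hm : 0 ≤ m) {V₁ V₂ : R3 → ℝ} (hV₁ : IsTrapping V₁)
    (hV₂ : IsTrapping V₂) {a₁ a₂ β : ℝ} (ha₁ : 0 < a₁) (ha₂ : 0 < a₂) (hη : 1 < eta a₁ a₂ β)
    (hne : (constraintSet V₁ V₂).Nonempty) : ∃ w, IsMinimizer m V₁ V₂ a₁ a₂ β w := by
  obtain ⟨c, hc, hcoer⟩ := exists_coercivity hm hV₁ hV₂ ha₁ ha₂ hη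
  have hT1 : ∀ w : L2 × L2, 0 ≤ kinetic m w.1 + potentialTerm V₁ w.1 := fun w =>
    add_nonneg (kinetic_nonneg m _) (hV₁.potentialTerm_nonneg _)
  have hT2 : ∀ w : L2 × L2, 0 ≤ kinetic m w.2 + potentialTerm V₂ w.2 := fun w =>
    add_nonneg (kinetic_nonneg m _) (hV₂.potentialTerm_nonneg _)
  have hT : ∀ w : L2 × L2, 0 ≤ positiveEnergy m V₁ V₂ w := fun w => add_nonneg (hT1 w) (hT2 w)
  set S := energy m V₁ V₂ a₁ a₂ β '' constraintSet V₁ V₂ with hS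
  have hSne : S.Nonempty := hne.image _
  have hSb : BddBelow S := by
    refine ⟨0, ?_⟩
    rintro _ ⟨w, hw, rfl⟩
    exact (mul_nonneg hc.le (hT w)).trans (hcoer w hw)
  obtain ⟨e, hanti, hlim, he⟩ := exists_seq_tendsto_sInf hSne hSb
  choose w hw hwe using he
  set C := e 0 / c with hC
  have hbound : ∀ n, positiveEnergy m V₁ V₂ (w n) ≤ C := fun n => by
    rw [hC, le_div_iff₀ hc, mul_comm]
    exact (hcoer _ (hw n)).trans ((hwe n).le.trans (hanti (Nat.zero_le n)))
  have hb1 : ∀ n, kinetic m (w n).1 + potentialTerm V₁ (w n).1 ≤ C := fun n =>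
    (le_add_of_nonneg_right (hT2 (w n))).trans (hbound n)
  have hb2 : ∀ n, kinetic m (w n).2 + potentialTerm V₂ (w n).2 ≤ C := fun n =>
    (le_add_of_nonneg_left (hT1 (w n))).trans (hbound n)
  obtain ⟨u, φ, hφ, hulim, hutrap, hunorm, hulsc⟩ := hV₁.exists_subseq_tendsto_lsc hm
    (u := fun n => (w n).1) (fun n => (hw n).1)
    (fun n => (integral_sq_eq_one_iff _).1 (hw n).2.2.1) hb1
  obtain ⟨v, ψ, hψ, hvlim, hvtrap, hvnorm, hvlsc⟩ := hV₂.exists_subseq_tendsto_lsc hm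
    (u := fun n => (w (φ n)).2) (fun n => (hw _).2.1)
    (fun n => (integral_sq_eq_one_iff _).1 (hw _).2.2.2) (fun n => hb2 _)
  have hulim' : Tendsto (fun n => (w (φ (ψ n))).1) atTop (nhds u) :=
    hulim.comp hψ.tendsto_atTop
  have hmem : (u, v) ∈ constraintSet V₁ V₂ :=
    ⟨hutrap, hvtrap, (integral_sq_eq_one_iff _).2 hunorm, (integral_sq_eq_one_iff _).2 hvnorm⟩
  have hG : ∀ {x : L2}, MemHHalf x → kinetic m x ≤ C →
      gagliardo x ≤ ENNReal.ofReal (gagliardoConst.toReal * C) := fun {x} hx hk => by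
    rw [gagliardo_eq_ofReal hx]
    refine ENNReal.ofReal_le_ofReal (mul_le_mul_of_nonneg_left ?_ gagliardoConst_toReal_pos.le)
    exact (quarterLaplacianSq_le_kinetic hm hx).trans hk
  have hG1 : ∀ n, gagliardo (w n).1 ≤ ENNReal.ofReal (gagliardoConst.toReal * C) := fun n =>
    hG (hw n).1.1 ((le_add_of_nonneg_right (hV₁.potentialTerm_nonneg _)).trans (hb1 n))
  have hG2 : ∀ n, gagliardo (w n).2 ≤ ENNReal.ofReal (gagliardoConst.toReal * C) := fun n =>
    hG (hw n).2.1.1 ((le_add_of_nonneg_right (hV₂.potentialTerm_nonneg _)).trans (hb2 n))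
  have t11 := tendsto_coulomb hulim' hulim' ENNReal.ofReal_ne_top (Eventually.of_forall fun n => hG1 _)
    hutrap.1 hutrap.1
  have t22 := tendsto_coulomb hvlim hvlim ENNReal.ofReal_ne_top (Eventually.of_forall fun n => hG2 _)
    hvtrap.1 hvtrap.1
  have t12 := tendsto_coulomb hulim' hvlim ENNReal.ofReal_ne_top (Eventually.of_forall fun n => hG1 _)
    hutrap.1 hvtrap.1
  have hθ : Tendsto (fun n => φ (ψ n)) atTop atTop := hφ.tendsto_atTop.comp hψ.tendsto_atTop
  have te : Tendsto (fun n => energy m V₁ V₂ a₁ a₂ β (w (φ (ψ n)))) atTop (nhds (sInf S)) := by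
    simp_rw [hwe]
    exact hlim.comp hθ
  have hle : energy m V₁ V₂ a₁ a₂ β (u, v) ≤ sInf S := by
    refine le_of_forall_pos_le_add fun ε hε => ?_
    -- Adding the Coulomb terms back to the energy leaves the positive part, which is lower
    -- semicontinuous; the added terms converge, whatever the sign of β.
    have tsum := te.add ((((t11.const_mul (a₁ / 2)).add (t22.const_mul (a₂ / 2))).add
      (t12.const_mul β)).add_const ε)
    have hev : ∀ᶠ n in atTop, positiveEnergy m V₁ V₂ (u, v) ≤
        energy m V₁ V₂ a₁ a₂ β (w (φ (ψ n))) +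
        (a₁ / 2 * coulomb (w (φ (ψ n))).1 (w (φ (ψ n))).1 +
          a₂ / 2 * coulomb (w (φ (ψ n))).2 (w (φ (ψ n))).2 +
          β * coulomb (w (φ (ψ n))).1 (w (φ (ψ n))).2 + ε) := by
      filter_upwards [hψ.tendsto_atTop.eventually (hulsc (ε / 2) (by positivity)),
        hvlsc (ε / 2) (by positivity)] with n h1 h2
      simp only [positiveEnergy, energy]
      linarith
    have := ge_of_tendsto tsum hev
    simp only [positiveEnergy] at this
    simp only [energy]
    linarith
  refine ⟨(u, v), hmem, le_antisymm ?_ (iInf₂_le _ hmem)⟩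
  refine le_iInf₂ fun w' hw' => ?_
  exact_mod_cast hle.trans (csInf_le hSb ⟨w', hw', rfl⟩)

/-! ### Compactly supported approximation -/

/-- `u` vanishes almost everywhere outside the closed ball of radius `R`. -/
def SupportedIn (R : ℝ) (u : L2) : Prop :=
  ∀ᵐ x : R3, x ∉ Metric.closedBall (0 : R3) R → u x = 0

/-- Local boundedness of V supplies the constant, its essential supremum on the ball. It depends on
R alone, so it is uniform along dilations that shrink supports. -/
theorem IsTrapping.exists_potentialTerm_le {V : R3 → ℝ} (hV : IsTrapping V) (R : ℝ) :
    ∃ S : ℝ, ∀ u : L2, SupportedIn R u →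
      Integrable (fun x => V x * u x ^ 2) ∧ potentialTerm V u ≤ S * ‖u‖ ^ 2 := by
  have hs : MeasurableSet (Metric.closedBall (0 : R3) R) := measurableSet_closedBall
  have hmem := hV.locBounded _ (isCompact_closedBall (0 : R3) R)
  set S := (eLpNorm V ∞ (volume.restrict (Metric.closedBall (0 : R3) R))).toReal with hS
  have hb : ∀ᵐ x ∂(volume.restrict (Metric.closedBall (0 : R3) R)), ‖V x‖ ≤ S := by
    filter_upwards [ae_le_eLpNormEssSup (f := V)
      (μ := volume.restrict (Metric.closedBall (0 : R3) R))] with x hx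
    rw [← eLpNorm_exponent_top] at hx
    rw [hS, ← toReal_enorm]
    exact ENNReal.toReal_mono hmem.2.ne hx
  refine ⟨S, fun u hu => ?_⟩
  have hi : IntegrableOn (fun x => V x * u x ^ 2) (Metric.closedBall (0 : R3) R) :=
    (integrable_sq u).integrableOn.bdd_mul hmem.1 hb
  have hind : (fun x => V x * u x ^ 2) =ᵐ[volume]
      (Metric.closedBall (0 : R3) R).indicator fun x => V x * u x ^ 2 := by
    filter_upwards [hu] with x hx
    by_cases h : x ∈ Metric.closedBall (0 : R3) R
    · rw [Set.indicator_of_mem h]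
    · rw [Set.indicator_of_notMem h, hx h]
      simp
  refine ⟨((integrable_indicator_iff hs).2 hi).congr hind.symm, ?_⟩
  rw [potentialTerm, integral_congr_ae hind, integral_indicator hs, ← integral_sq_coeFn,
    ← integral_const_mul]
  calc ∫ x in Metric.closedBall (0 : R3) R, V x * u x ^ 2
      ≤ ∫ x in Metric.closedBall (0 : R3) R, S * u x ^ 2 := by
        refine integral_mono_ae hi ((integrable_sq u).const_mul S).integrableOn ?_
        filter_upwards [hb] with x hx
        exact mul_le_mul_of_nonneg_right ((le_abs_self _).trans hx) (sq_nonneg _)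
    _ ≤ ∫ x, S * u x ^ 2 :=
        setIntegral_le_integral ((integrable_sq u).const_mul S)
          (Eventually.of_forall fun x => mul_nonneg ENNReal.toReal_nonneg (sq_nonneg _))

theorem gagliardo_const_mul (c : ℝ) (f : R3 → ℝ) :
    gagliardo (fun x => c * f x) = ENNReal.ofReal (c ^ 2) * gagliardo f := by
  unfold gagliardo
  rw [← lintegral_const_mul' _ _ ENNReal.ofReal_ne_top]
  refine lintegral_congr fun h => ?_
  rw [← lintegral_const_mul' _ _ ENNReal.ofReal_ne_top]
  refine lintegral_congr fun x => ?_
  rw [← ENNReal.ofReal_mul (by positivity)]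
  congr 1
  ring

theorem gagliardo_smul (c : ℝ) (u : L2) :
    gagliardo (c • u : L2) = ENNReal.ofReal (c ^ 2) * gagliardo u := by
  rw [gagliardo_congr_ae (Lp.coeFn_smul c u), ← gagliardo_const_mul]
  rfl

theorem gagliardo_toLp {f : R3 → ℝ} (hf : MemLp f 2 volume) :
    gagliardo (hf.toLp f) = gagliardo f := gagliardo_congr_ae hf.coeFn_toLp

theorem coulombE_congr_ae {f f' g g' : R3 → ℝ} (hf : f =ᵐ[volume] f') (hg : g =ᵐ[volume] g') :
    coulombE f g = coulombE f' g' := by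
  refine lintegral_congr_ae ?_
  filter_upwards [hg] with x hx
  refine lintegral_congr_ae ?_
  filter_upwards [hf] with y hy
  rw [hx, hy]

/-- A Lipschitz cutoff equal to `1` on the ball of radius `n+1` and to `0` outside the ball of
radius `2(n+1)`. -/
def cutoff (n : ℕ) (x : R3) : ℝ := max 0 (min 1 (2 - ‖x‖ / (n + 1)))

theorem continuous_cutoff (n : ℕ) : Continuous (cutoff n) := by
  unfold cutoff
  have : ((n : ℝ) + 1) ≠ 0 := by positivity
  fun_prop

theorem cutoff_nonneg (n : ℕ) (x : R3) : 0 ≤ cutoff n x := le_max_left _ _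

theorem cutoff_le_one (n : ℕ) (x : R3) : cutoff n x ≤ 1 := max_le zero_le_one (min_le_left _ _)

theorem abs_cutoff_sub_le (n : ℕ) (x y : R3) : |cutoff n x - cutoff n y| ≤ ‖x - y‖ := by
  have h1 : |cutoff n x - cutoff n y| ≤ |(2 - ‖x‖ / (n + 1)) - (2 - ‖y‖ / (n + 1))| := by
    simp only [cutoff, max_comm (0 : ℝ), min_comm (1 : ℝ)]
    exact (abs_max_sub_max_le_abs _ _ _).trans (abs_inf_sub_inf_le_abs _ _ _)
  refine h1.trans ?_
  have h2 : (2 - ‖x‖ / ((n : ℝ) + 1)) - (2 - ‖y‖ / (n + 1)) = (‖y‖ - ‖x‖) / (n + 1) := by ring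
  rw [h2, abs_div, abs_of_pos (by positivity : (0 : ℝ) < n + 1), div_le_iff₀ (by positivity)]
  have h3 := abs_norm_sub_norm_le y x
  rw [norm_sub_rev] at h3
  nlinarith [norm_nonneg (x - y), (Nat.cast_nonneg n : (0 : ℝ) ≤ n)]

/-- The bound is uniform in n, and dividing it by |h|⁴ leaves an integrable function of h; this is
what permits dominated convergence for truncations. -/
theorem sq_cutoff_sub_le (n : ℕ) (x y : R3) :
    (cutoff n x - cutoff n y) ^ 2 ≤ min 1 (‖x - y‖ ^ 2) := by
  rw [← sq_abs]
  refine le_min ?_ (by gcongr; exact abs_cutoff_sub_le n x y)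
  rw [sq_le_one_iff_abs_le_one, abs_abs, abs_le]
  constructor <;> linarith [cutoff_nonneg n x, cutoff_le_one n x, cutoff_nonneg n y,
    cutoff_le_one n y]

theorem cutoff_eq_zero {n : ℕ} {x : R3} (hx : x ∉ Metric.closedBall (0 : R3) (2 * (n + 1))) :
    cutoff n x = 0 := by
  rw [mem_closedBall_zero_iff, not_le] at hx
  refine max_eq_left ((min_le_right _ _).trans ?_)
  rw [sub_nonpos, le_div_iff₀ (by positivity)]
  exact hx.le

theorem tendsto_cutoff (x : R3) : Tendsto (fun n => cutoff n x) atTop (nhds 1) := by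
  refine tendsto_const_nhds.congr' ?_
  obtain ⟨N, hN⟩ := exists_nat_ge ‖x‖
  filter_upwards [eventually_ge_atTop N] with n hn
  have : ‖x‖ / ((n : ℝ) + 1) ≤ 1 := by
    rw [div_le_one (by positivity)]
    have : (N : ℝ) ≤ n := by exact_mod_cast hn
    linarith
  rw [cutoff, min_eq_left (by linarith), max_eq_right zero_le_one]

theorem memLp_cutoff_mul (n : ℕ) (u : L2) : MemLp (fun x => cutoff n x * u x) 2 volume := by
  refine (Lp.memLp u).mono ((continuous_cutoff n).aestronglyMeasurable.mul
    (Lp.aestronglyMeasurable u)) (Eventually.of_forall fun x => ?_)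
  rw [norm_mul, Real.norm_eq_abs, abs_of_nonneg (cutoff_nonneg n x)]
  exact mul_le_of_le_one_left (norm_nonneg _) (cutoff_le_one n x)

/-- Multiplication of `u` by the cutoff. -/
def truncate (n : ℕ) (u : L2) : L2 := (memLp_cutoff_mul n u).toLp _

theorem coeFn_truncate (n : ℕ) (u : L2) :
    truncate n u =ᵐ[volume] fun x => cutoff n x * u x := (memLp_cutoff_mul n u).coeFn_toLp

theorem supportedIn_truncate (n : ℕ) (u : L2) : SupportedIn (2 * (n + 1)) (truncate n u) := by
  filter_upwards [coeFn_truncate n u] with x hx h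
  rw [hx, cutoff_eq_zero h, zero_mul]

theorem tendsto_truncate (u : L2) : Tendsto (fun n => truncate n u) atTop (nhds u) := by
  rw [tendsto_iff_norm_sub_tendsto_zero]
  have hm := measurable_coeFn u
  have h : Tendsto (fun n => ∫⁻ x, ENNReal.ofReal (((cutoff n x - 1) * u x) ^ 2)) atTop
      (nhds (∫⁻ _ : R3, 0)) := by
    refine tendsto_lintegral_of_dominated_convergence (fun x => ENNReal.ofReal (u x ^ 2))
      (fun n => ?_) (fun n => Eventually.of_forall fun x => ENNReal.ofReal_le_ofReal ?_) ?_
      (Eventually.of_forall fun x => ?_)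
    · have := (continuous_cutoff n).measurable
      fun_prop
    · rw [mul_pow]
      refine mul_le_of_le_one_left (sq_nonneg _) ?_
      nlinarith [cutoff_nonneg n x, cutoff_le_one n x]
    · rw [lintegral_sq_coeFn]; exact ENNReal.ofReal_ne_top
    · have := ENNReal.tendsto_ofReal ((((tendsto_cutoff x).sub_const 1).mul_const (u x)).pow 2)
      simpa using this
  have h2 : ∀ n, ∫⁻ x, ENNReal.ofReal (((cutoff n x - 1) * u x) ^ 2) =
      ENNReal.ofReal (‖truncate n u - u‖ ^ 2) := fun n => by
    rw [← lintegral_sq_coeFn]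
    refine lintegral_congr_ae ?_
    filter_upwards [Lp.coeFn_sub (truncate n u) u, coeFn_truncate n u] with x h1 h2
    rw [h1, Pi.sub_apply, h2, sub_mul, one_mul]
  simp_rw [h2] at h
  rw [lintegral_zero] at h
  have h3 := (ENNReal.tendsto_toReal ENNReal.zero_ne_top).comp h
  simp only [Function.comp_def, ENNReal.toReal_zero] at h3
  have h4 : Tendsto (fun n => Real.sqrt ((ENNReal.ofReal (‖truncate n u - u‖ ^ 2)).toReal)) atTop
      (nhds (Real.sqrt 0)) := h3.sqrt
  rw [Real.sqrt_zero] at h4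
  refine h4.congr fun n => ?_
  rw [ENNReal.toReal_ofReal (by positivity), Real.sqrt_sq (norm_nonneg _)]

theorem gagliardo_eq_lintegral_prod {f : R3 → ℝ} (hf : Measurable f) :
    gagliardo f = ∫⁻ p : R3 × R3, ENNReal.ofReal ((f (p.2 + p.1) - f p.2) ^ 2 / ‖p.1‖ ^ 4) := by
  rw [Measure.volume_eq_prod, lintegral_prod _ (by fun_prop)]
  rfl

/-- Dominated convergence on pairs (h, x): writing sa - tb = s(a-b) + (s-t)b separates the Gagliardo
density of u from a cutoff error dominated by a product of integrable functions. -/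
theorem tendsto_gagliardo_truncate {u : L2} (hu : MemHHalf u) :
    Tendsto (fun n => gagliardo (truncate n u)) atTop (nhds (gagliardo u)) := by
  have hm := measurable_coeFn u
  have hG := ((memHHalf_iff_gagliardo u).1 hu).ne
  have e : ∀ n, gagliardo (truncate n u) = ∫⁻ p : R3 × R3, ENNReal.ofReal
      ((cutoff n (p.2 + p.1) * u (p.2 + p.1) - cutoff n p.2 * u p.2) ^ 2 / ‖p.1‖ ^ 4) := fun n => by
    have := (continuous_cutoff n).measurable
    rw [gagliardo_congr_ae (coeFn_truncate n u), gagliardo_eq_lintegral_prod (by fun_prop)]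
  simp_rw [e]
  rw [gagliardo_eq_lintegral_prod hm] at hG ⊢
  refine tendsto_lintegral_of_dominated_convergence (fun p : R3 × R3 =>
    ENNReal.ofReal 2 * ENNReal.ofReal ((u (p.2 + p.1) - u p.2) ^ 2 / ‖p.1‖ ^ 4) +
      ENNReal.ofReal 2 * (ENNReal.ofReal (min 1 (‖p.1‖ ^ 2) / ‖p.1‖ ^ 4) *
        ENNReal.ofReal (u p.2 ^ 2)))
    (fun n => ?_) (fun n => Eventually.of_forall fun p => ?_) ?_ (Eventually.of_forall fun p => ?_)
  · have := (continuous_cutoff n).measurable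
    fun_prop
  · beta_reduce
    rw [← ENNReal.ofReal_mul (by positivity), ← ENNReal.ofReal_mul (by positivity),
      ← ENNReal.ofReal_mul (by positivity), ← ENNReal.ofReal_add (by positivity) (by positivity)]
    refine ENNReal.ofReal_le_ofReal ?_
    set a := u (p.2 + p.1)
    set b := u p.2
    set s := cutoff n (p.2 + p.1)
    set t := cutoff n p.2
    have h1 : (s - t) ^ 2 ≤ min 1 (‖p.1‖ ^ 2) := by
      simpa using sq_cutoff_sub_le n (p.2 + p.1) p.2
    have h2 : s ^ 2 ≤ 1 := by nlinarith [cutoff_nonneg n (p.2 + p.1), cutoff_le_one n (p.2 + p.1)]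
    have h3 : (s * a - t * b) ^ 2 ≤ 2 * (a - b) ^ 2 + 2 * (min 1 (‖p.1‖ ^ 2) * b ^ 2) := by
      have e : s * a - t * b = s * (a - b) + (s - t) * b := by ring
      rw [e]
      have i1 : (s * (a - b)) ^ 2 ≤ (a - b) ^ 2 := by
        rw [mul_pow]; exact mul_le_of_le_one_left (sq_nonneg _) h2
      have i2 : ((s - t) * b) ^ 2 ≤ min 1 (‖p.1‖ ^ 2) * b ^ 2 := by
        rw [mul_pow]; exact mul_le_mul_of_nonneg_right h1 (sq_nonneg _)
      nlinarith [sq_nonneg (s * (a - b) - (s - t) * b)]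
    calc (s * a - t * b) ^ 2 / ‖p.1‖ ^ 4
        ≤ (2 * (a - b) ^ 2 + 2 * (min 1 (‖p.1‖ ^ 2) * b ^ 2)) / ‖p.1‖ ^ 4 := by gcongr
      _ = _ := by ring
  · rw [lintegral_add_left (by fun_prop), lintegral_const_mul' _ _ ENNReal.ofReal_ne_top,
      lintegral_const_mul' _ _ ENNReal.ofReal_ne_top, Measure.volume_eq_prod,
      lintegral_prod_mul (f := fun h : R3 => ENNReal.ofReal (min 1 (‖h‖ ^ 2) / ‖h‖ ^ 4))
        (g := fun x => ENNReal.ofReal (u x ^ 2)) (by fun_prop) (by fun_prop), lintegral_sq_coeFn]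
    refine ENNReal.add_ne_top.2 ⟨ENNReal.mul_ne_top ENNReal.ofReal_ne_top hG,
      ENNReal.mul_ne_top ENNReal.ofReal_ne_top (ENNReal.mul_ne_top
        integrable_min_one_sq_div.lintegral_lt_top.ne ENNReal.ofReal_ne_top)⟩
  · have := ENNReal.tendsto_ofReal (((((tendsto_cutoff (p.2 + p.1)).mul_const (u (p.2 + p.1))).sub
      ((tendsto_cutoff p.2).mul_const (u p.2))).pow 2).div_const (‖p.1‖ ^ 4))
    simpa using this

theorem SupportedIn.smul {R : ℝ} {u : L2} (h : SupportedIn R u) (c : ℝ) :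
    SupportedIn R (c • u) := by
  filter_upwards [h, Lp.coeFn_smul c u] with x hx hc hR
  rw [hc, Pi.smul_apply, hx hR, smul_zero]

/-- Normalized elements of `H^{1/2}` are approximated by normalized ones of compact support. -/
theorem exists_seq_supportedIn {u : L2} (hu : MemHHalf u) (hn : ‖u‖ = 1) :
    ∃ v : ℕ → L2, (∀ᶠ n in atTop, ‖v n‖ = 1) ∧ Tendsto v atTop (nhds u) ∧
      Tendsto (fun n => gagliardo (v n)) atTop (nhds (gagliardo u)) ∧
      ∀ n, ∃ R, SupportedIn R (v n) := by
  have ht := tendsto_truncate u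
  have hnt : Tendsto (fun n => ‖truncate n u‖) atTop (nhds 1) := by simpa [hn] using ht.norm
  have hinv : Tendsto (fun n => ‖truncate n u‖⁻¹) atTop (nhds 1) := by
    simpa using hnt.inv₀ one_ne_zero
  refine ⟨fun n => ‖truncate n u‖⁻¹ • truncate n u, ?_, ?_, ?_, fun n =>
    ⟨_, (supportedIn_truncate n u).smul _⟩⟩
  -- Normalization holds only eventually: an early truncation may vanish, and its inverse norm is
  -- then 0.
  · filter_upwards [hnt.eventually_ne one_ne_zero] with n h
    rw [norm_smul, norm_inv, norm_norm, inv_mul_cancel₀ h]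
  · simpa using hinv.smul ht
  · simp_rw [gagliardo_smul]
    have h1 : Tendsto (fun n => ENNReal.ofReal (‖truncate n u‖⁻¹ ^ 2)) atTop (nhds 1) := by
      simpa using ENNReal.tendsto_ofReal (hinv.pow 2)
    simpa using ENNReal.Tendsto.mul h1 (Or.inl one_ne_zero) (tendsto_gagliardo_truncate hu)
      (Or.inr ENNReal.one_ne_top)

/-- For fixed h the difference vanishes unless x or x + h lies in the support ball, so the
x-integral costs at most twice its volume. -/
theorem gagliardo_cutoff_lt_top : gagliardo (cutoff 0) < ∞ := by
  set B := Metric.closedBall (0 : R3) (2 * ((0 : ℕ) + 1)) with hB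
  have hBm : MeasurableSet B := measurableSet_closedBall
  have key : ∀ h : R3, ∫⁻ x, ENNReal.ofReal ((cutoff 0 (x + h) - cutoff 0 x) ^ 2 / ‖h‖ ^ 4) ≤
      ENNReal.ofReal (min 1 (‖h‖ ^ 2) / ‖h‖ ^ 4) * (volume B + volume B) := by
    intro h
    calc _ ≤ ∫⁻ x, ENNReal.ofReal (min 1 (‖h‖ ^ 2) / ‖h‖ ^ 4) *
          (B.indicator 1 x + B.indicator 1 (x + h)) := by
          refine lintegral_mono fun x => ?_
          by_cases hx : x ∈ B ∨ x + h ∈ B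
          · have h1 : (1 : ℝ≥0∞) ≤ B.indicator 1 x + B.indicator 1 (x + h) := by
              rcases hx with hx | hx
              · rw [Set.indicator_of_mem hx]; exact le_self_add
              · rw [Set.indicator_of_mem hx]; exact le_add_self
            refine le_trans ?_ (mul_le_mul' le_rfl h1)
            rw [mul_one]
            refine ENNReal.ofReal_le_ofReal ?_
            have := sq_cutoff_sub_le 0 (x + h) x
            rw [add_sub_cancel_left] at this
            gcongr
          · push Not at hx
            rw [cutoff_eq_zero hx.1, cutoff_eq_zero hx.2]
            simp
      _ = _ := by
          rw [lintegral_const_mul' _ _ ENNReal.ofReal_ne_top,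
            lintegral_add_left (measurable_one.indicator hBm),
            lintegral_add_right_eq_self (fun x => B.indicator (1 : R3 → ℝ≥0∞) x) h,
            lintegral_indicator_one hBm]
  refine (lintegral_mono key).trans_lt ?_
  have hv : volume B + volume B ≠ ∞ :=
    ENNReal.add_ne_top.2 ⟨measure_closedBall_lt_top.ne, measure_closedBall_lt_top.ne⟩
  rw [lintegral_mul_const' _ _ hv]
  exact ENNReal.mul_lt_top integrable_min_one_sq_div.lintegral_lt_top hv.lt_top

/-- This bump shows that the constraint set is nonempty, and serves as the fixed component when only
the other one is concentrated. -/
theorem exists_normalized_supportedIn :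
    ∃ (z : L2) (R : ℝ), MemHHalf z ∧ ‖z‖ = 1 ∧ SupportedIn R z := by
  have hsupp : HasCompactSupport (cutoff 0) :=
    HasCompactSupport.intro (isCompact_closedBall (0 : R3) (2 * ((0 : ℕ) + 1)))
      fun x hx => cutoff_eq_zero hx
  have hmem : MemLp (cutoff 0) 2 (volume : Measure R3) :=
    (continuous_cutoff 0).memLp_of_hasCompactSupport hsupp
  set u : L2 := hmem.toLp _ with hu
  have hs : SupportedIn (2 * ((0 : ℕ) + 1)) u := by
    filter_upwards [hmem.coeFn_toLp] with x hx h
    rw [hx, cutoff_eq_zero h]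
  have hu0 : u ≠ 0 := by
    intro h
    have h1 : cutoff 0 =ᵐ[volume] fun _ : R3 => (0 : ℝ) := by
      have h2 := hmem.coeFn_toLp
      rw [← hu, h] at h2
      exact h2.symm.trans (Lp.coeFn_zero ℝ 2 volume)
    have h3 := congrFun ((continuous_cutoff 0).ae_eq_iff_eq volume continuous_const |>.1 h1) 0
    simp [cutoff] at h3
  refine ⟨‖u‖⁻¹ • u, _, ?_, ?_, hs.smul _⟩
  · rw [memHHalf_iff_gagliardo, gagliardo_smul, gagliardo_toLp]
    exact ENNReal.mul_lt_top ENNReal.ofReal_lt_top gagliardo_cutoff_lt_top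
  · rw [norm_smul, norm_inv, norm_norm, inv_mul_cancel₀ (norm_ne_zero_iff.2 hu0)]

theorem constraintSet_nonempty {V₁ V₂ : R3 → ℝ} (hV₁ : IsTrapping V₁) (hV₂ : IsTrapping V₂) :
    (constraintSet V₁ V₂).Nonempty := by
  obtain ⟨z, R, hz, hn, hs⟩ := exists_normalized_supportedIn
  obtain ⟨S₁, h₁⟩ := hV₁.exists_potentialTerm_le R
  obtain ⟨S₂, h₂⟩ := hV₂.exists_potentialTerm_le R
  exact ⟨(z, z), ⟨hz, (h₁ z hs).1⟩, ⟨hz, (h₂ z hs).1⟩, (integral_sq_eq_one_iff z).2 hn,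
    (integral_sq_eq_one_iff z).2 hn⟩

/-! ### Mass-preserving dilations -/

/-- The function `x ↦ t^{3/2} f(tx)`. -/
def dilateFun (t : ℝ) (f : R3 → ℝ) (x : R3) : ℝ := Real.sqrt (t ^ 3) * f (t • x)

theorem sq_dilateFun {t : ℝ} (ht : 0 < t) (f : R3 → ℝ) (x : R3) :
    dilateFun t f x ^ 2 = t ^ 3 * f (t • x) ^ 2 := by
  rw [dilateFun, mul_pow, Real.sq_sqrt (by positivity)]

theorem measurable_dilateFun (t : ℝ) {f : R3 → ℝ} (hf : Measurable f) :
    Measurable (dilateFun t f) := by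
  unfold dilateFun
  fun_prop

theorem lintegral_sq_dilateFun {t : ℝ} (ht : 0 < t) (f : R3 → ℝ) :
    ∫⁻ x, ENNReal.ofReal (dilateFun t f x ^ 2) = ∫⁻ x, ENNReal.ofReal (f x ^ 2) := by
  simp_rw [sq_dilateFun ht, ENNReal.ofReal_mul (show 0 ≤ t ^ 3 by positivity)]
  rw [lintegral_const_mul' _ _ ENNReal.ofReal_ne_top,
    lintegral_comp_smul (fun x => ENNReal.ofReal (f x ^ 2)) ht, ← mul_assoc,
    ← ENNReal.ofReal_mul (by positivity), mul_inv_cancel₀ (by positivity), ENNReal.ofReal_one,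
    one_mul]

theorem gagliardo_dilateFun {t : ℝ} (ht : 0 < t) (f : R3 → ℝ) :
    gagliardo (dilateFun t f) = ENNReal.ofReal t * gagliardo f := by
  let Φ : R3 → ℝ≥0∞ := fun h => ∫⁻ x, ENNReal.ofReal ((f (x + h) - f x) ^ 2 / ‖h‖ ^ 4)
  have h1 : ∀ h : R3, ∫⁻ x, ENNReal.ofReal
      ((dilateFun t f (x + h) - dilateFun t f x) ^ 2 / ‖h‖ ^ 4) =
      ENNReal.ofReal (t ^ 4) * Φ (t • h) := by
    intro h
    have e : ∀ x, ENNReal.ofReal ((dilateFun t f (x + h) - dilateFun t f x) ^ 2 / ‖h‖ ^ 4) =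
        ENNReal.ofReal (t ^ 4 * t ^ 3) * ENNReal.ofReal
          ((f (t • x + t • h) - f (t • x)) ^ 2 / ‖t • h‖ ^ 4) := fun x => by
      rw [← ENNReal.ofReal_mul (by positivity), dilateFun, dilateFun, smul_add, ← mul_sub, mul_pow,
        Real.sq_sqrt (by positivity), norm_smul, Real.norm_eq_abs, abs_of_pos ht, mul_pow]
      congr 1
      field_simp
    simp_rw [e]
    rw [lintegral_const_mul' _ _ ENNReal.ofReal_ne_top,
      lintegral_comp_smul (fun x => ENNReal.ofReal ((f (x + t • h) - f x) ^ 2 / ‖t • h‖ ^ 4)) ht,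
      ← mul_assoc, ← ENNReal.ofReal_mul (by positivity), mul_assoc (t ^ 4),
      mul_inv_cancel₀ (by positivity), mul_one]
  rw [gagliardo]
  simp_rw [h1]
  rw [lintegral_const_mul' _ _ ENNReal.ofReal_ne_top, lintegral_comp_smul Φ ht, ← mul_assoc,
    ← ENNReal.ofReal_mul (by positivity)]
  have : t ^ 4 * (t ^ 3)⁻¹ = t := by field_simp
  rw [this]
  rfl

theorem coulombE_dilateFun {t : ℝ} (ht : 0 < t) (f g : R3 → ℝ) :
    coulombE (dilateFun t f) (dilateFun t g) = ENNReal.ofReal t * coulombE f g := by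
  let Φ : R3 → ℝ≥0∞ := fun x => ∫⁻ y, ENNReal.ofReal (f y ^ 2 / ‖x - y‖ * g x ^ 2)
  have h1 : ∀ x : R3, ∫⁻ y, ENNReal.ofReal
      (dilateFun t f y ^ 2 / ‖x - y‖ * dilateFun t g x ^ 2) =
      ENNReal.ofReal (t ^ 4) * Φ (t • x) := by
    intro x
    have e : ∀ y, ENNReal.ofReal (dilateFun t f y ^ 2 / ‖x - y‖ * dilateFun t g x ^ 2) =
        ENNReal.ofReal (t ^ 4 * t ^ 3) * ENNReal.ofReal
          (f (t • y) ^ 2 / ‖t • x - t • y‖ * g (t • x) ^ 2) := fun y => by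
      rw [← ENNReal.ofReal_mul (by positivity), sq_dilateFun ht, sq_dilateFun ht, ← smul_sub,
        norm_smul, Real.norm_eq_abs, abs_of_pos ht]
      congr 1
      field_simp
    simp_rw [e]
    rw [lintegral_const_mul' _ _ ENNReal.ofReal_ne_top,
      lintegral_comp_smul (fun y => ENNReal.ofReal (f y ^ 2 / ‖t • x - y‖ * g (t • x) ^ 2)) ht,
      ← mul_assoc, ← ENNReal.ofReal_mul (by positivity), mul_assoc (t ^ 4),
      mul_inv_cancel₀ (by positivity), mul_one]
  rw [coulombE]
  simp_rw [h1]
  rw [lintegral_const_mul' _ _ ENNReal.ofReal_ne_top, lintegral_comp_smul Φ ht, ← mul_assoc,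
    ← ENNReal.ofReal_mul (by positivity)]
  have : t ^ 4 * (t ^ 3)⁻¹ = t := by field_simp
  rw [this]
  rfl

theorem memLp_two_of_lintegral {f : R3 → ℝ} (hf : Measurable f)
    (h : ∫⁻ x, ENNReal.ofReal (f x ^ 2) ≠ ∞) : MemLp f 2 volume :=
  (memLp_two_iff_integrable_sq hf.aestronglyMeasurable).2
    ((lintegral_ofReal_ne_top_iff_integrable (by fun_prop)
      (Eventually.of_forall fun _ => sq_nonneg _)).1 h)

/-- Dilations of `L²` functions are in `L²`. -/
theorem exists_dilate (u : L2) {t : ℝ} (ht : 0 < t) :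
    ∃ v : L2, v =ᵐ[volume] dilateFun t u := by
  have h := memLp_two_of_lintegral (measurable_dilateFun t (measurable_coeFn u))
    (by rw [lintegral_sq_dilateFun ht, lintegral_sq_coeFn]; exact ENNReal.ofReal_ne_top)
  exact ⟨h.toLp _, h.coeFn_toLp⟩

theorem norm_eq_of_dilate {t : ℝ} (ht : 0 < t) {u u' : L2}
    (hu : u' =ᵐ[volume] dilateFun t u) : ‖u'‖ = ‖u‖ := by
  have h : ENNReal.ofReal (‖u'‖ ^ 2) = ENNReal.ofReal (‖u‖ ^ 2) := by
    rw [← lintegral_sq_coeFn, ← lintegral_sq_coeFn, ← lintegral_sq_dilateFun ht u]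
    refine lintegral_congr_ae ?_
    filter_upwards [hu] with x hx
    rw [hx]
  rw [ENNReal.ofReal_eq_ofReal_iff (by positivity) (by positivity)] at h
  exact (pow_left_inj₀ (norm_nonneg _) (norm_nonneg _) two_ne_zero).1 h

theorem gagliardo_of_dilate {t : ℝ} (ht : 0 < t) {u u' : L2}
    (hu : u' =ᵐ[volume] dilateFun t u) : gagliardo u' = ENNReal.ofReal t * gagliardo u := by
  rw [gagliardo_congr_ae hu, gagliardo_dilateFun ht]

theorem memHHalf_of_dilate {t : ℝ} (ht : 0 < t) {u u' : L2}
    (hu : u' =ᵐ[volume] dilateFun t u) (h : MemHHalf u) : MemHHalf u' := by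
  rw [memHHalf_iff_gagliardo, gagliardo_of_dilate ht hu]
  exact ENNReal.mul_lt_top ENNReal.ofReal_lt_top ((memHHalf_iff_gagliardo u).1 h)

theorem quarterLaplacianSq_of_dilate {t : ℝ} (ht : 0 < t) {u u' : L2}
    (hu : u' =ᵐ[volume] dilateFun t u) : quarterLaplacianSq u' = t * quarterLaplacianSq u := by
  rw [quarterLaplacianSq_eq, quarterLaplacianSq_eq, gagliardo_of_dilate ht hu, ENNReal.toReal_mul,
    ENNReal.toReal_ofReal ht.le, mul_div_assoc]

/-- For t ≥ 1 dilation shrinks supports, so the same R works for all such t and the potential energy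
stays bounded as t → ∞. -/
theorem supportedIn_of_dilate {t : ℝ} (ht : 0 < t) {u u' : L2}
    (hu : u' =ᵐ[volume] dilateFun t u) (ht1 : 1 ≤ t) {R : ℝ} (h : SupportedIn R u) :
    SupportedIn R u' := by
  have hq : Measure.QuasiMeasurePreserving (fun x : R3 => t • x) volume volume := by
    refine ⟨by fun_prop, ?_⟩
    change Measure.map (t • ·) volume ≪ volume
    rw [Measure.map_addHaar_smul _ ht.ne']
    exact Measure.smul_absolutelyContinuous
  filter_upwards [hu, hq.ae h] with x hx hs hR
  rw [hx, dilateFun, hs, mul_zero]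
  rw [mem_closedBall_zero_iff, not_le] at hR ⊢
  rw [norm_smul, Real.norm_eq_abs, abs_of_pos ht]
  nlinarith [norm_nonneg x]

theorem coulomb_of_dilate {t : ℝ} (ht : 0 < t) {u v u' v' : L2}
    (hu : u' =ᵐ[volume] dilateFun t u) (hv : v' =ᵐ[volume] dilateFun t v)
    (h : MemHHalf u) : coulomb u' v' = t * coulomb u v := by
  rw [coulomb_eq_toReal (memHHalf_of_dilate ht hu h), coulomb_eq_toReal h, coulombE_congr_ae hu hv,
    coulombE_dilateFun ht, ENNReal.toReal_mul, ENNReal.toReal_ofReal ht.le]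

/-! ### Energy unbounded below when η < 1 -/

theorem exists_le_sub_mul_lt {A B d : ℝ} (hd : 0 < d) : ∃ t : ℝ, 1 ≤ t ∧ A - t * d < B := by
  refine ⟨max 1 ((A - B) / d + 1), le_max_left _ _, ?_⟩
  have h1 : (A - B) / d + 1 ≤ max 1 ((A - B) / d + 1) := le_max_right _ _
  have h2 := mul_le_mul_of_nonneg_right h1 hd.le
  have h3 : ((A - B) / d + 1) * d = A - B + d := by field_simp
  linarith

/-- Concentrating both components makes the energy unbounded below. -/
theorem exists_energy_lt_of_pair {m : ℝ} (hm : 0 ≤ m) {V₁ V₂ : R3 → ℝ} (hV₁ : IsTrapping V₁)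
    (hV₂ : IsTrapping V₂) {a₁ a₂ β : ℝ} {u v : L2} (hu : MemHHalf u) (hv : MemHHalf v)
    (hun : ‖u‖ = 1) (hvn : ‖v‖ = 1) {R R' : ℝ} (hus : SupportedIn R u) (hvs : SupportedIn R' v)
    (hlt : 2 * quarterLaplacianSq u + 2 * quarterLaplacianSq v <
      a₁ * coulomb u u + a₂ * coulomb v v + 2 * β * coulomb u v) (B : ℝ) :
    ∃ w ∈ constraintSet V₁ V₂, energy m V₁ V₂ a₁ a₂ β w < B := by
  obtain ⟨S₁, hS₁⟩ := hV₁.exists_potentialTerm_le R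
  obtain ⟨S₂, hS₂⟩ := hV₂.exists_potentialTerm_le R'
  set d := (a₁ * coulomb u u + a₂ * coulomb v v + 2 * β * coulomb u v) / 2 -
    (quarterLaplacianSq u + quarterLaplacianSq v) with hd
  -- √(|2πξ|²+m²) ≤ 2π|ξ| + m costs m per component and the potentials cost `S₁ + S₂`; everything
  -- else scales as -t·d with d > 0.
  obtain ⟨t, ht1, ht⟩ := exists_le_sub_mul_lt (A := 2 * m + S₁ + S₂) (B := B) (d := d) (by linarith)
  have ht0 : 0 < t := by linarith
  obtain ⟨u', hu'⟩ := exists_dilate u ht0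
  obtain ⟨v', hv'⟩ := exists_dilate v ht0
  have hum := memHHalf_of_dilate ht0 hu' hu
  have hvm := memHHalf_of_dilate ht0 hv' hv
  have hun' := (norm_eq_of_dilate ht0 hu').trans hun
  have hvn' := (norm_eq_of_dilate ht0 hv').trans hvn
  obtain ⟨iu, pu⟩ := hS₁ u' (supportedIn_of_dilate ht0 hu' ht1 hus)
  obtain ⟨iv, pv⟩ := hS₂ v' (supportedIn_of_dilate ht0 hv' ht1 hvs)
  refine ⟨(u', v'), ⟨⟨hum, iu⟩, ⟨hvm, iv⟩, (integral_sq_eq_one_iff _).2 hun',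
    (integral_sq_eq_one_iff _).2 hvn'⟩, lt_of_le_of_lt ?_ ht⟩
  have ku := kinetic_le hm hum
  have kv := kinetic_le hm hvm
  rw [hun', one_pow, mul_one] at ku pu
  rw [hvn', one_pow, mul_one] at kv pv
  rw [quarterLaplacianSq_of_dilate ht0 hu'] at ku
  rw [quarterLaplacianSq_of_dilate ht0 hv'] at kv
  simp only [energy]
  rw [coulomb_of_dilate ht0 hu' hu' hu, coulomb_of_dilate ht0 hv' hv' hv,
    coulomb_of_dilate ht0 hu' hv' hu, hd]
  linarith

/-- Concentrating the first component makes the energy unbounded below. -/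
theorem exists_energy_lt_of_left {m : ℝ} (hm : 0 ≤ m) {V₁ V₂ : R3 → ℝ} (hV₁ : IsTrapping V₁)
    (hV₂ : IsTrapping V₂) {a₁ a₂ β : ℝ} {u : L2} (hu : MemHHalf u) (hun : ‖u‖ = 1) {R : ℝ}
    (hus : SupportedIn R u) (hlt : 2 * quarterLaplacianSq u < a₁ * coulomb u u) (B : ℝ) :
    ∃ w ∈ constraintSet V₁ V₂, energy m V₁ V₂ a₁ a₂ β w < B := by
  obtain ⟨z, R', hz, hzn, hzs⟩ := exists_normalized_supportedIn
  obtain ⟨S₁, hS₁⟩ := hV₁.exists_potentialTerm_le R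
  obtain ⟨S₂, hS₂⟩ := hV₂.exists_potentialTerm_le R'
  obtain ⟨iz, -⟩ := hS₂ z hzs
  -- `Z` collects all that does not grow with t. The cross term belongs there: Hardy's inequality
  -- applied to the fixed `z` bounds it through the norm of `u'`, which is 1.
  set Z := kinetic m z + potentialTerm V₂ z - a₂ / 2 * coulomb z z +
    |β| * (hardyConst * gagliardo z).toReal with hZ
  obtain ⟨t, ht1, ht⟩ := exists_le_sub_mul_lt (A := m + S₁ + Z) (B := B)
    (d := a₁ * coulomb u u / 2 - quarterLaplacianSq u) (by linarith)
  have ht0 : 0 < t := by linarith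
  obtain ⟨u', hu'⟩ := exists_dilate u ht0
  have hum := memHHalf_of_dilate ht0 hu' hu
  have hun' := (norm_eq_of_dilate ht0 hu').trans hun
  obtain ⟨iu, pu⟩ := hS₁ u' (supportedIn_of_dilate ht0 hu' ht1 hus)
  refine ⟨(u', z), ⟨⟨hum, iu⟩, ⟨hz, iz⟩, (integral_sq_eq_one_iff _).2 hun',
    (integral_sq_eq_one_iff _).2 hzn⟩, lt_of_le_of_lt ?_ ht⟩
  have ku := kinetic_le hm hum
  have hc := coulomb_le hz u'
  rw [hun', one_pow, mul_one] at ku pu hc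
  rw [quarterLaplacianSq_of_dilate ht0 hu'] at ku
  have hβ : -(β * coulomb z u') ≤ |β| * (hardyConst * gagliardo z).toReal := by
    calc -(β * coulomb z u') = (-β) * coulomb z u' := by ring
      _ ≤ |β| * coulomb z u' :=
          mul_le_mul_of_nonneg_right (neg_le_abs β) (coulomb_nonneg z u')
      _ ≤ _ := mul_le_mul_of_nonneg_left hc (abs_nonneg β)
  simp only [energy]
  rw [coulomb_of_dilate ht0 hu' hu' hu, coulomb_comm hum hz]
  linarith

theorem energy_swap {m : ℝ} {V₁ V₂ : R3 → ℝ} {a₁ a₂ β : ℝ} {w : L2 × L2}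
    (hw : w ∈ constraintSet V₁ V₂) :
    energy m V₂ V₁ a₂ a₁ β w.swap = energy m V₁ V₂ a₁ a₂ β w := by
  simp only [energy, Prod.fst_swap, Prod.snd_swap]
  rw [coulomb_comm hw.2.1.1 hw.1.1]
  ring

theorem swap_mem_constraintSet {V₁ V₂ : R3 → ℝ} {w : L2 × L2} (hw : w ∈ constraintSet V₁ V₂) :
    w.swap ∈ constraintSet V₂ V₁ := ⟨hw.2.1, hw.1, hw.2.2.2, hw.2.2.1⟩

theorem exists_energy_lt_of_right {m : ℝ} (hm : 0 ≤ m) {V₁ V₂ : R3 → ℝ} (hV₁ : IsTrapping V₁)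
    (hV₂ : IsTrapping V₂) {a₁ a₂ β : ℝ} {v : L2} (hv : MemHHalf v) (hvn : ‖v‖ = 1) {R : ℝ}
    (hvs : SupportedIn R v) (hlt : 2 * quarterLaplacianSq v < a₂ * coulomb v v) (B : ℝ) :
    ∃ w ∈ constraintSet V₁ V₂, energy m V₁ V₂ a₁ a₂ β w < B := by
  obtain ⟨w, hw, hE⟩ := exists_energy_lt_of_left (a₂ := a₁) (β := β) hm hV₂ hV₁ hv hvn hvs hlt B
  refine ⟨w.swap, swap_mem_constraintSet hw, ?_⟩
  rwa [energy_swap hw]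

theorem tendsto_quarterLaplacianSq {v : ℕ → L2} {u : L2} (hu : MemHHalf u)
    (h : Tendsto (fun n => gagliardo (v n)) atTop (nhds (gagliardo u))) :
    Tendsto (fun n => quarterLaplacianSq (v n)) atTop (nhds (quarterLaplacianSq u)) := by
  simp_rw [quarterLaplacianSq_eq]
  exact ((ENNReal.tendsto_toReal ((memHHalf_iff_gagliardo u).1 hu).ne).comp h).div_const _

/-- A pair with quotient below 1 satisfies a strict inequality between quantities continuous along
compactly supported approximations, so it survives truncation; dilation then drives the energy down.
-/
theorem exists_energy_lt_of_eta_lt_one {m : ℝ} (hm : 0 ≤ m) {V₁ V₂ : R3 → ℝ}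
    (hV₁ : IsTrapping V₁) (hV₂ : IsTrapping V₂) {a₁ a₂ β : ℝ} (ha₁ : 0 < a₁) (ha₂ : 0 < a₂)
    (hη : eta a₁ a₂ β < 1) (B : ℝ) :
    ∃ w ∈ constraintSet V₁ V₂, energy m V₁ V₂ a₁ a₂ β w < B := by
  obtain ⟨⟨u, v⟩, hw, hJ⟩ : ∃ w, ∃ _ : w ∈ normalizedPairs, (quotientJ a₁ a₂ β w : EReal) < 1 := by
    simpa only [eta, iInf_lt_iff] using hη
  obtain ⟨hu, hv, hun, hvn⟩ := hw
  simp only at hu hv hun hvn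
  rw [integral_sq_eq_one_iff] at hun hvn
  have hJ : quotientJ a₁ a₂ β (u, v) < 1 := by exact_mod_cast hJ
  have hu0 : u ≠ 0 := fun h => by simp [h] at hun
  have hpos : 0 < a₁ * coulomb u u + a₂ * coulomb v v + 2 * max 0 β * coulomb u v := by
    have h1 := mul_pos ha₁ (coulomb_pos hu hu0)
    have h2 := mul_nonneg ha₂.le (coulomb_nonneg v v)
    have h3 : 0 ≤ 2 * max 0 β * coulomb u v :=
      mul_nonneg (mul_nonneg zero_le_two (le_max_left _ _)) (coulomb_nonneg u v)
    linarith
  rw [quotientJ, div_lt_one hpos] at hJ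
  simp only at hJ
  obtain ⟨f, hfn, hft, hfG, hfs⟩ := exists_seq_supportedIn hu hun
  obtain ⟨g, hgn, hgt, hgG, hgs⟩ := exists_seq_supportedIn hv hvn
  have hGu := ((memHHalf_iff_gagliardo u).1 hu)
  have hGv := ((memHHalf_iff_gagliardo v).1 hv)
  have hfb : ∀ᶠ n in atTop, gagliardo (f n) ≤ gagliardo u + 1 :=
    hfG.eventually_le_const (ENNReal.lt_add_right hGu.ne one_ne_zero)
  have hgb : ∀ᶠ n in atTop, gagliardo (g n) ≤ gagliardo v + 1 :=
    hgG.eventually_le_const (ENNReal.lt_add_right hGv.ne one_ne_zero)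
  have hMu : gagliardo u + 1 ≠ ∞ := ENNReal.add_ne_top.2 ⟨hGu.ne, ENNReal.one_ne_top⟩
  have hMv : gagliardo v + 1 ≠ ∞ := ENNReal.add_ne_top.2 ⟨hGv.ne, ENNReal.one_ne_top⟩
  have tQu := (tendsto_quarterLaplacianSq hu hfG).const_mul 2
  have tQv := (tendsto_quarterLaplacianSq hv hgG).const_mul 2
  have tuu := (tendsto_coulomb hft hft hMu hfb hu hu).const_mul a₁
  have tvv := (tendsto_coulomb hgt hgt hMv hgb hv hv).const_mul a₂
  have mf : ∀ᶠ n in atTop, MemHHalf (f n) := hfb.mono fun n h =>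
    (memHHalf_iff_gagliardo _).2 (h.trans_lt hMu.lt_top)
  have mg : ∀ᶠ n in atTop, MemHHalf (g n) := hgb.mono fun n h =>
    (memHHalf_iff_gagliardo _).2 (h.trans_lt hMv.lt_top)
  rcases le_or_gt 0 β with hβ | hβ
  · rw [max_eq_right hβ] at hJ
    have tuv := (tendsto_coulomb hft hgt hMu hfb hu hv).const_mul (2 * β)
    obtain ⟨n, h1, h2, h3, h4, h5⟩ := (((tQu.add tQv).eventually_lt ((tuu.add tvv).add tuv)
      hJ).and (hfn.and (hgn.and (mf.and mg)))).exists
    obtain ⟨R, hR⟩ := hfs n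
    obtain ⟨R', hR'⟩ := hgs n
    exact exists_energy_lt_of_pair hm hV₁ hV₂ h4 h5 h2 h3 hR hR' h1 B
  -- With β⁺ = 0 the inequality is a sum over components, so it holds for one of them alone.
  -- Concentrating both would make the repulsion grow linearly in t as well.
  · rw [max_eq_left hβ.le] at hJ
    by_cases hc : 2 * quarterLaplacianSq u < a₁ * coulomb u u
    · obtain ⟨n, h1, h2, h3⟩ := ((tQu.eventually_lt tuu hc).and (hfn.and mf)).exists
      obtain ⟨R, hR⟩ := hfs n
      exact exists_energy_lt_of_left hm hV₁ hV₂ h3 h2 hR h1 B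
    · have hc' : 2 * quarterLaplacianSq v < a₂ * coulomb v v := by linarith
      obtain ⟨n, h1, h2, h3⟩ := ((tQv.eventually_lt tvv hc').and (hgn.and mg)).exists
      obtain ⟨R, hR⟩ := hgs n
      exact exists_energy_lt_of_right hm hV₁ hV₂ h3 h2 hR h1 B

end PseudoHartree

end

/-! ### The existence and nonexistence theorem -/

theorem theorem2p1 (m : ℝ) (hm : 0 < m) (V₁ V₂ : PseudoHartree.R3 → ℝ)
    (hV₁ : PseudoHartree.IsTrapping V₁) (hV₂ : PseudoHartree.IsTrapping V₂)
    (a₁ a₂ β : ℝ) (ha₁ : 0 < a₁) (ha₂ : 0 < a₂) :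
    (1 < PseudoHartree.eta a₁ a₂ β →
      ∃ w : PseudoHartree.L2 × PseudoHartree.L2,
        PseudoHartree.IsMinimizer m V₁ V₂ a₁ a₂ β w) ∧
    (PseudoHartree.eta a₁ a₂ β < 1 →
      ¬ ∃ w : PseudoHartree.L2 × PseudoHartree.L2,
        PseudoHartree.IsMinimizer m V₁ V₂ a₁ a₂ β w) := by
  refine ⟨fun hη => ?_, ?_⟩
  · exact PseudoHartree.exists_isMinimizer hm.le hV₁ hV₂ ha₁ ha₂ hη
      (PseudoHartree.constraintSet_nonempty hV₁ hV₂)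
  · rintro hη ⟨w, -, hmin⟩
    -- The energy of a supposed minimizer is a real number, so it can serve as the level to
    -- undercut.
    obtain ⟨w', hw', hlt⟩ := PseudoHartree.exists_energy_lt_of_eta_lt_one hm.le hV₁ hV₂ ha₁ ha₂ hη
      (PseudoHartree.energy m V₁ V₂ a₁ a₂ β w)
    have hle : (PseudoHartree.energy m V₁ V₂ a₁ a₂ β w : EReal) ≤
        PseudoHartree.energy m V₁ V₂ a₁ a₂ β w' := hmin.le.trans (iInf₂_le w' hw')
    exact absurd (by exact_mod_cast hle) (not_le.2 hlt)
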